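/- In a cube complex any two cubes that meet intersect in a common face. A cube complex is CAT(0) if it is simply connected and the link of each of its 0-cubes is a flag simplicial complex. Its dimension is the largest dimension of one of its cubes, and its maximum degree is the largest number of 1-cubes containing a given 0-cube. The hyperplanes of a cube complex correspond to the classes of the equivalence relation on 1-cubes generated by "being opposite edges of a 2-cube"; two distinct hyperplanes cross if some 2-cube has two consecutive edges dual to one and to the other. The crossing graph has the hyperplanes as vertices and the crossing pairs as edges. An isometric embedding of a CAT(0) cube complex $\mathbf X$ into a Cartesian product of trees $T_1\times\dots\times T_k$ is a map $f$ from the 0-cubes of $\mathbf X$ to the vertices of the product such that $d(x,y)=\sum_{i=1}^k d_{T_i}(f_i(x),f_i(y))$ for all $x,y$, where $d$ is the path metric of the 1-skeleton of $\mathbf X$ and $d_{T_i}$ is that of $T_i$. **Theorem.** (1) There is a constant $\Delta$ such that for every $n\ge 0$ there is a finite CAT(0) cube complex $\mathbf X_n$ of maximum degree $\Delta$ such that every colouring of the crossing graph of $\mathbf X_n$ requires more than $n$ colours, and every isometric embedding of $\mathbf X_n$ into a Cartesian product of finitely many trees requires more than $n$ trees. (2) There is an infinite CAT(0) cube complex $\mathbf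 X$ of dimension 5 and of finite maximum degree such that the crossing graph of $\mathbf X$ has infinite chromatic number, and $\mathbf X$ does not embed isometrically into any Cartesian product of finitely many trees. -/

import Mathlib

universe v w

/-- The face of the standard cube `{0,1}^d` obtained by fixing the coordinates in `S`
to the values prescribed by `a`. -/
def stdFace {d : ℕ} (S : Set (Fin d)) (a : Fin d → Bool) : Set (Fin d → Bool) :=
  {x | ∀ i ∈ S, x i = a i}

/-- `e` identifies the vertices of the standard `d`-cube with the set `c`, in such a way that the
members of `cubes` contained in `c` are exactly the images of the faces of the standard cube. -/
structure IsCubeParam {V : Type*} (cubes : Set (Set V)) {d : ℕ} (e : (Fin d → Bool) → V)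
    (c : Set V) : Prop where
  injective : Function.Injective e
  range_eq : Set.range e = c
  mem_iff : ∀ s : Set V, s ⊆ c →
    (s ∈ cubes ↔ ∃ (S : Set (Fin d)) (a : Fin d → Bool), s = e '' stdFace S a)

/-- A cube complex with set of `0`-cubes `V`, each cube being recorded by its set of vertices:
every point of `V` is a `0`-cube, every cube is combinatorially a standard cube with all its faces,
and two cubes that meet intersect in a common face (a cube contained in `c` is a face of `c`). -/
structure CubeComplex (V : Type*) where
  cubes : Set (Set V)
  singleton_mem : ∀ v : V, {v} ∈ cubes
  exists_param : ∀ c ∈ cubes, ∃ (d : ℕ) (e : (Fin d → Bool) → V), IsCubeParam cubes e c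
  inter_mem : ∀ c ∈ cubes, ∀ c' ∈ cubes, (c ∩ c').Nonempty → c ∩ c' ∈ cubes

namespace CubeComplex

variable {V : Type*} (X : CubeComplex V)

/-- `c` is a `d`-cube of `X`. -/
def IsCube (d : ℕ) (c : Set V) : Prop :=
  c ∈ X.cubes ∧ ∃ e : (Fin d → Bool) → V, IsCubeParam X.cubes e c

/-- The dimension of `X` is `d`: the largest dimension of a cube of `X`. -/
def HasDim (d : ℕ) : Prop :=
  IsGreatest {k : ℕ | ∃ c : Set V, X.IsCube k c} d

/-- The `1`-skeleton of `X`, as a graph. -/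
def skel : SimpleGraph V where
  Adj u v := u ≠ v ∧ ({u, v} : Set V) ∈ X.cubes
  symm := ⟨fun u v h => ⟨h.1.symm, by rw [Set.pair_comm]; exact h.2⟩⟩
  loopless := ⟨fun _ h => h.1 rfl⟩

/-- The largest degree of a `0`-cube of `X`, i.e. number of `1`-cubes containing it, is the
(finite) number `D`. -/
def HasMaxDegree (D : ℕ) : Prop :=
  IsGreatest (Set.range fun v : V => (X.skel.neighborSet v).encard) (D : ℕ∞)

/-- `a, b, c, d` are the vertices of a `2`-cube of `X`, listed in cyclic order. -/
structure IsSquare (a b c d : V) : Prop where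
  isCube : X.IsCube 2 {a, b, c, d}
  ab : X.skel.Adj a b
  bc : X.skel.Adj b c
  cd : X.skel.Adj c d
  da : X.skel.Adj d a

/-- Homotopy, with fixed endpoints, of paths in the `1`-skeleton: the equivalence relation
generated by inserting or deleting a backtrack and by replacing two consecutive edges of a
`2`-cube with the two other edges of that `2`-cube. -/
inductive PathHomotopic : {u v : V} → X.skel.Walk u v → X.skel.Walk u v → Prop
  | refl {u v : V} (p : X.skel.Walk u v) : PathHomotopic p p
  | symm {u v : V} {p q : X.skel.Walk u v} : PathHomotopic p q → PathHomotopic q p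
  | trans {u v : V} {p q r : X.skel.Walk u v} :
      PathHomotopic p q → PathHomotopic q r → PathHomotopic p r
  | cons {u v w : V} (h : X.skel.Adj u v) {p q : X.skel.Walk v w} :
      PathHomotopic p q → PathHomotopic (.cons h p) (.cons h q)
  | backtrack {u v w : V} (h : X.skel.Adj u v) (p : X.skel.Walk u w) :
      PathHomotopic (.cons h (.cons h.symm p)) p
  | square {a b c d w : V} (h : X.IsSquare a b c d) (p : X.skel.Walk c w) :
      PathHomotopic (.cons h.ab (.cons h.bc p)) (.cons h.da.symm (.cons h.cd.symm p))

/-- `X` is simply connected: it is (nonempty and) connected and its edge-path group is trivial. -/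
def IsSimplyConnected : Prop :=
  X.skel.Connected ∧ ∀ (v : V) (p : X.skel.Walk v v), X.PathHomotopic p .nil

/-- The simplices of the link of the `0`-cube `v`. The vertices of the link are the neighbours of
`v`, one for each `1`-cube at `v`; a cube containing `v` gives the simplex spanned by the
neighbours of `v` in this cube. (The cube `{v}` gives the empty simplex.) -/
def link (v : V) : Set (Set V) :=
  {S | ∃ c ∈ X.cubes, v ∈ c ∧ S = {u | u ∈ c ∧ X.skel.Adj v u}}

/-- The link of `v` is a flag complex: every finite set of vertices of the link which are pairwise
joined by an edge of the link spans a simplex. -/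
def IsFlagLink (v : V) : Prop :=
  ∀ S : Set V, S.Finite → (∀ u ∈ S, X.skel.Adj v u) →
    (∀ u ∈ S, ∀ w ∈ S, u ≠ w → ({u, w} : Set V) ∈ X.link v) → S ∈ X.link v

/-- `X` is a CAT(0) cube complex: simply connected, with flag links. -/
def IsCAT0 : Prop :=
  X.IsSimplyConnected ∧ ∀ v : V, X.IsFlagLink v

/-- Two `1`-cubes are opposite edges of a `2`-cube. -/
def Opposite (e f : X.skel.edgeSet) : Prop :=
  ∃ a b c d : V, X.IsSquare a b c d ∧ (e : Sym2 V) = s(a, b) ∧ (f : Sym2 V) = s(d, c)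

/-- The hyperplanes of `X`, a hyperplane being given by the set of `1`-cubes dual to it: these are
the classes of the equivalence relation on `1`-cubes generated by `Opposite`. -/
def Hyperplane : Type _ := Quot X.Opposite

/-- The hyperplane dual to a `1`-cube. -/
def dualHyperplane (e : X.skel.edgeSet) : X.Hyperplane := Quot.mk _ e

/-- The crossing graph of `X`: its vertices are the hyperplanes, and two distinct hyperplanes are
adjacent if they cross, i.e. if they are dual to two consecutive edges of some `2`-cube. -/
def crossingGraph : SimpleGraph X.Hyperplane where
  Adj H H' := H ≠ H' ∧ ∃ (a b c d : V) (h : X.IsSquare a b c d),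
    X.dualHyperplane ⟨s(a, b), h.ab⟩ = H ∧ X.dualHyperplane ⟨s(b, c), h.bc⟩ = H'
  symm := ⟨by
    rintro H H' ⟨hne, a, b, c, d, h, rfl, rfl⟩
    refine ⟨hne.symm, c, b, a, d, ⟨?_, h.bc.symm, h.ab.symm, h.da.symm, h.cd.symm⟩, ?_, ?_⟩
    · have hs : ({c, b, a, d} : Set V) = {a, b, c, d} := by
        ext x
        simp only [Set.mem_insert_iff, Set.mem_singleton_iff]
        tauto
      rw [hs]
      exact h.isCube
    · exact congrArg X.dualHyperplane (Subtype.ext Sym2.eq_swap)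
    · exact congrArg X.dualHyperplane (Subtype.ext Sym2.eq_swap)⟩
  loopless := ⟨fun _ h => h.1 rfl⟩

end CubeComplex

/-- `X` embeds isometrically into the Cartesian product of `k` trees: there is a map from the
vertices of `X` to those of the product that preserves distances, for the path metric of the
`1`-skeleton of `X` and for the sum of the path metrics of the trees. -/
def CubeComplex.EmbedsInTrees {V : Type v} (X : CubeComplex V) (k : ℕ) : Prop :=
  ∃ (T : Fin k → Type w) (G : ∀ i, SimpleGraph (T i)), (∀ i, (G i).IsTree) ∧
    ∃ f : V → ∀ i, T i, ∀ x y : V,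
      X.skel.dist x y = ∑ i, (G i).dist (f x i) (f y i)

/-!
In an isometric embedding into `k` trees every edge moves exactly one coordinate. Opposite edges
of a square move the same one and, as trees have no cycles, consecutive edges move different ones.
The hyperplanes are thus properly coloured with `k` colours, so that it suffices to make the
chromatic number of the crossing graph large.

The finite configurations of a poset of events with a binary inconsistency relation form a CAT(0)
cube complex whose hyperplanes are events: the number of elements of a configuration is a
combinatorial Morse function, and events that can be flipped independently in pairs can be flipped
independently all together. To a family of boxes (interval times subtree) in the product of a path
and a binary tree we attach the events of moving along the path, of moving down the tree, and of
entering a box. Boxes with a common point give crossing hyperplanes, and the degrees of the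
complex exceed the largest number of boxes through a point by at most `5`.

Burling's construction yields boxes, at most two through each point, whose intersection graphs
have unbounded chromatic number. The inductive invariant is that for every proper colouring some
ray, a probe, enters boxes of at least `k` colours. At the start of each probe place a small copy
of the system itself, in which every probe has been doubled so that one copy of it enters a new
box crossing all the boxes of the other. If some inner colour is missing outside, the first copy
of the probe sees `k + 1` colours; otherwise the colour of the new box adds to the outer ones on
the second copy.
-/

namespace CubeComplex

variable {V : Type*} {X : CubeComplex V}

theorem PathHomotopic.append_right {u v w : V} {p q : X.skel.Walk u v}
    (h : X.PathHomotopic p q) (s : X.skel.Walk v w) :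
    X.PathHomotopic (p.append s) (q.append s) := by
  induction h with
  | refl p => exact .refl _
  | symm _ ih => exact (ih s).symm
  | trans _ _ ih₁ ih₂ => exact (ih₁ s).trans (ih₂ s)
  | cons h _ ih => exact .cons h (ih s)
  | backtrack h p => exact .backtrack h (p.append s)
  | square h p => exact .square h (p.append s)

theorem PathHomotopic.append_left {u v w : V} (s : X.skel.Walk u v) {p q : X.skel.Walk v w}
    (h : X.PathHomotopic p q) : X.PathHomotopic (s.append p) (s.append q) := by
  induction s with
  | nil => exact h
  | cons e _ ih => exact .cons e (ih h)

theorem pathHomotopic_append_reverse {u v : V} (p : X.skel.Walk u v) :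
    X.PathHomotopic (p.append p.reverse) .nil := by
  induction p with
  | nil => exact .refl _
  | cons h p ih =>
    rw [SimpleGraph.Walk.reverse_cons, SimpleGraph.Walk.cons_append,
      SimpleGraph.Walk.append_assoc]
    exact ((ih.append_right (.cons h.symm .nil)).cons h).trans (.backtrack h .nil)

/-- A combinatorial Morse function on the vertices of `X`: every vertex other than the root `r`
has a neighbour of smaller rank, and two such neighbours span a descending square. -/
structure IsMorseRank (X : CubeComplex V) (r : V) (h : V → ℕ) : Prop where
  rank_root : h r = 0
  rank_ne_of_adj : ∀ ⦃u v⦄, X.skel.Adj u v → h u ≠ h v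
  exists_lower : ∀ v, v ≠ r → ∃ u, X.skel.Adj v u ∧ h u < h v
  exists_square : ∀ v u w, X.skel.Adj v u → X.skel.Adj v w → h u < h v → h w < h v → u ≠ w →
    ∃ x, X.IsSquare v u x w ∧ h x < h u ∧ h x < h w

namespace IsMorseRank

variable {r : V} {h : V → ℕ}

open Classical in
/-- A path from `v` to the root along which the rank decreases. -/
noncomputable def descent (H : X.IsMorseRank r h) (v : V) : X.skel.Walk v r :=
  if hv : v = r then SimpleGraph.Walk.nil.copy hv.symm rfl
  else .cons (H.exists_lower v hv).choose_spec.1 (H.descent (H.exists_lower v hv).choose)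
termination_by h v
decreasing_by exact (H.exists_lower v hv).choose_spec.2

theorem exists_descent_eq_cons (H : X.IsMorseRank r h) {v : V} (hv : v ≠ r) :
    ∃ (w : V) (e : X.skel.Adj v w), h w < h v ∧ H.descent v = .cons e (H.descent w) :=
  ⟨_, _, (H.exists_lower v hv).choose_spec.2, by rw [descent, dif_neg hv]⟩

theorem descent_pathHomotopic_cons (H : X.IsMorseRank r h) {v u : V} (e : X.skel.Adj v u)
    (huv : h u < h v) : X.PathHomotopic (H.descent v) (.cons e (H.descent u)) := by
  induction hn : h v using Nat.strong_induction_on generalizing v u with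
  | _ n ih =>
    subst hn
    have hv : v ≠ r := by
      rintro rfl
      exact Nat.not_lt_zero _ (H.rank_root ▸ huv)
    obtain ⟨w, hw, hwv, descent_eq⟩ := H.exists_descent_eq_cons hv
    rw [descent_eq]
    obtain rfl | huw := eq_or_ne u w
    · exact .refl _
    obtain ⟨x, hx, hxu, hxw⟩ := H.exists_square v u w e hw huv hwv huw
    have via_u := (ih _ huv hx.bc hxu rfl).cons e
    have via_w := (ih _ hwv hx.cd.symm hxw rfl).cons hw
    exact via_w.trans ((PathHomotopic.square hx _).symm.trans via_u.symm)

theorem append_descent_pathHomotopic (H : X.IsMorseRank r h) {u v : V} (p : X.skel.Walk u v) :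
    X.PathHomotopic (p.append (H.descent v)) (H.descent u) := by
  induction p with
  | nil => exact .refl _
  | @cons u v w e p ih =>
    refine (ih.cons e).trans ?_
    obtain hlt | hlt := (H.rank_ne_of_adj e).lt_or_gt
    · exact ((H.descent_pathHomotopic_cons e.symm hlt).cons e).trans (.backtrack e _)
    · exact (H.descent_pathHomotopic_cons e hlt).symm

theorem isSimplyConnected (H : X.IsMorseRank r h) : X.IsSimplyConnected := by
  have : Nonempty V := ⟨r⟩
  refine ⟨⟨fun u v => ⟨(H.descent u).append (H.descent v).reverse⟩⟩, fun v p => ?_⟩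
  have insert_loop := (pathHomotopic_append_reverse (H.descent v)).append_left p
  have contract := (H.append_descent_pathHomotopic p).append_right (H.descent v).reverse
  rw [SimpleGraph.Walk.append_nil] at insert_loop
  rw [SimpleGraph.Walk.append_assoc] at insert_loop
  exact insert_loop.symm.trans (contract.trans (pathHomotopic_append_reverse _))

end IsMorseRank

theorem IsSquare.rotate {a b c d : V} (h : X.IsSquare a b c d) : X.IsSquare b c d a where
  isCube := by
    have : ({b, c, d, a} : Set V) = {a, b, c, d} := by grind
    exact this ▸ h.isCube
  ab := h.bc
  bc := h.cd
  cd := h.da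
  da := h.ab

theorem IsSquare.ne_ac {a b c d : V} (h : X.IsSquare a b c d) : a ≠ c := by
  rintro rfl
  obtain ⟨-, e, he⟩ := h.isCube
  have card_eq : ({a, b, a, d} : Set V).ncard = 4 := by
    rw [← he.range_eq, ← Set.image_univ, Set.ncard_image_of_injective _ he.injective]
    simp
  rw [Set.insert_comm, Set.insert_eq_of_mem (Set.mem_insert a _)] at card_eq
  have card_le := Set.ncard_insert_le b {a, d}
  have := Set.ncard_insert_le a {d}
  rw [Set.ncard_singleton] at this
  omega

theorem IsSquare.ne_bd {a b c d : V} (h : X.IsSquare a b c d) : b ≠ d := h.rotate.ne_ac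

theorem exists_hasMaxDegree [Nonempty V] {B : ℕ}
    (hB : ∀ v, (X.skel.neighborSet v).encard ≤ B) : ∃ D ≤ B, X.HasMaxDegree D := by
  have isLUB := isLUB_iSup (f := fun v => (X.skel.neighborSet v).encard)
  have le_B := iSup_le hB
  obtain ⟨v, hv⟩ := ENat.exists_eq_iSup_of_lt_top (le_B.trans_lt (ENat.natCast_lt_top B))
  obtain ⟨D, hD⟩ := ENat.ne_top_iff_exists.1 (ne_top_of_le_ne_top (ENat.natCast_ne_top B) le_B)
  rw [← hD] at isLUB hv le_B
  exact ⟨D, by exact_mod_cast le_B, ⟨v, hv⟩, isLUB.1⟩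

end CubeComplex

theorem eq_of_adj_of_adj_of_isAcyclic {V : Type*} {G : SimpleGraph V} (hG : G.IsAcyclic)
    {a b y t : V} (hab : a ≠ b) (hay : G.Adj a y) (hyb : G.Adj y b) (hat : G.Adj a t)
    (htb : G.Adj t b) : y = t := by
  have isPath {x : V} (h₁ : G.Adj a x) (h₂ : G.Adj x b) :
      (SimpleGraph.Walk.cons h₁ (.cons h₂ .nil)).IsPath := by
    simp [h₁.ne, h₂.ne, hab]
  have := congrArg Subtype.val
    ((hG.subsingleton_path a b).elim ⟨_, isPath hay hyb⟩ ⟨_, isPath hat htb⟩)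
  simp only [SimpleGraph.Walk.cons.injEq] at this
  exact this.1

section EdgeDirection

variable {I : Type*} {T : I → Type*} {G : ∀ i, SimpleGraph (T i)} {i j k l : I} {x y z t : ∀ i, T i}

/-- The points `x` and `y` of a product of graphs are joined by an edge of the product, and `i` is
the only coordinate in which they differ. -/
def EdgeDirection (G : ∀ i, SimpleGraph (T i)) (i : I) (x y : ∀ i, T i) : Prop :=
  (G i).Adj (x i) (y i) ∧ ∀ j ≠ i, x j = y j

theorem EdgeDirection.symm (h : EdgeDirection G i x y) : EdgeDirection G i y x :=
  ⟨h.1.symm, fun j hj => (h.2 j hj).symm⟩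

theorem EdgeDirection.eq_of_apply_eq (hy : EdgeDirection G i x y) (ht : EdgeDirection G i x t)
    (h : y i = t i) : y = t := by
  funext j
  obtain rfl | hj := eq_or_ne j i
  · exact h
  · rw [← hy.2 j hj, ht.2 j hj]

theorem exists_edgeDirection_of_sum_dist_eq_one [Fintype I] (hG : ∀ i, (G i).Connected)
    (h : ∑ i, (G i).dist (x i) (y i) = 1) : ∃ i, EdgeDirection G i x y := by
  classical
  obtain ⟨i, -, hi⟩ := Finset.exists_ne_zero_of_sum_ne_zero (h.trans_ne one_ne_zero)
  rw [← Finset.add_sum_erase _ _ (Finset.mem_univ i)] at h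
  refine ⟨i, SimpleGraph.dist_eq_one_iff_adj.1 (by omega), fun j hj => ?_⟩
  have rest_eq_zero : ∑ j ∈ Finset.univ.erase i, (G j).dist (x j) (y j) = 0 := by omega
  exact (hG j).dist_eq_zero_iff.1 (Finset.sum_eq_zero_iff.1 rest_eq_zero j (by simp [hj]))

theorem EdgeDirection.ne_of_square (hG : ∀ i, (G i).IsAcyclic) (hxz : x ≠ z) (hyt : y ≠ t)
    (hxy : EdgeDirection G i x y) (hyz : EdgeDirection G j y z) (htz : EdgeDirection G k t z)
    (hxt : EdgeDirection G l x t) : i ≠ j := by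
  rintro rfl
  have x_ne_z : x i ≠ z i := fun h => hxz (hxy.symm.eq_of_apply_eq hyz h)
  have eq_off {m : I} (hm : m ≠ i) : x m = z m := (hxy.2 m hm).trans (hyz.2 m hm)
  have k_eq : k = i := by
    by_contra hk
    obtain rfl : l = i := by
      by_contra hl
      exact x_ne_z ((hxt.2 i (Ne.symm hl)).trans (htz.2 i (Ne.symm hk)))
    exact htz.1.ne ((hxt.2 k hk).symm.trans (eq_off hk))
  subst k_eq
  have l_eq : l = k := by
    by_contra hl
    exact hxt.1.ne ((eq_off hl).trans (htz.2 l hl).symm)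
  subst l_eq
  exact hyt (hxy.eq_of_apply_eq hxt
    (eq_of_adj_of_adj_of_isAcyclic (hG l) x_ne_z hxy.1 hyz.1 hxt.1 htz.1))

theorem EdgeDirection.eq_of_square (hij : i ≠ j) (hyt : y ≠ t)
    (hxy : EdgeDirection G i x y) (hyz : EdgeDirection G j y z) (htz : EdgeDirection G k t z)
    (hxt : EdgeDirection G l x t) : i = k := by
  by_contra hik
  have y_eq_t : y i = t i := (hyz.2 i hij).trans (htz.2 i hik).symm
  obtain rfl : l = i := by
    by_contra hl
    exact hxy.1.ne ((hxt.2 i (Ne.symm hl)).trans y_eq_t.symm)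
  exact hyt (hxy.eq_of_apply_eq hxt y_eq_t)

end EdgeDirection

theorem CubeComplex.EmbedsInTrees.colorable {V : Type v} {X : CubeComplex V} {k : ℕ}
    (h : EmbedsInTrees.{v, w} X k) : X.crossingGraph.Colorable k := by
  obtain ⟨T, G, hG, f, hf⟩ := h
  have ne_of_reachable {x y : V} (hxy : x ≠ y) (h : X.skel.Reachable x y) : f x ≠ f y := by
    refine fun hfxy => hxy (h.dist_eq_zero_iff.1 ?_)
    simp [hf, hfxy]
  have exists_direction (e : X.skel.edgeSet) :
      ∃ i, ∀ a b, (e : Sym2 V) = s(a, b) → EdgeDirection G i (f a) (f b) := by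
    obtain ⟨⟨a, b⟩, hab⟩ := e
    obtain ⟨i, hi⟩ := exists_edgeDirection_of_sum_dist_eq_one (fun i => (hG i).1)
      ((hf a b).symm.trans (SimpleGraph.dist_eq_one_iff_adj.2 hab))
    refine ⟨i, fun c d hcd => ?_⟩
    obtain ⟨rfl, rfl⟩ | ⟨rfl, rfl⟩ := Sym2.eq_iff.1 hcd
    exacts [hi, hi.symm]
  choose dir hdir using exists_direction
  have square {a b c d : V} (h : X.IsSquare a b c d) :
      dir ⟨s(a, b), h.ab⟩ ≠ dir ⟨s(b, c), h.bc⟩ ∧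
        dir ⟨s(a, b), h.ab⟩ = dir ⟨s(d, c), h.cd.symm⟩ := by
    have hbd := ne_of_reachable h.ne_bd (h.bc.reachable.trans h.cd.reachable)
    have ne := EdgeDirection.ne_of_square (fun i => (hG i).2)
      (ne_of_reachable h.ne_ac (h.ab.reachable.trans h.bc.reachable)) hbd
      (hdir ⟨_, h.ab⟩ a b rfl) (hdir ⟨_, h.bc⟩ b c rfl) (hdir ⟨_, h.cd.symm⟩ d c rfl)
      (hdir ⟨_, h.da.symm⟩ a d rfl)
    exact ⟨ne, EdgeDirection.eq_of_square ne hbd (hdir ⟨_, h.ab⟩ a b rfl)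
      (hdir ⟨_, h.bc⟩ b c rfl) (hdir ⟨_, h.cd.symm⟩ d c rfl) (hdir ⟨_, h.da.symm⟩ a d rfl)⟩
  refine ⟨SimpleGraph.Coloring.mk (Quot.lift dir ?_) ?_⟩
  · rintro ⟨e, he⟩ ⟨e', he'⟩ ⟨a, b, c, d, h, rfl, rfl⟩
    exact (square h).2
  · rintro _ _ ⟨-, a, b, c, d, h, rfl, rfl⟩
    exact (square h).1

open scoped symmDiff

theorem symmDiff_eq_iff_eq_symmDiff {α : Type*} [GeneralizedBooleanAlgebra α] {a b c : α} :
    a ∆ b = c ↔ b = a ∆ c :=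
  ⟨fun h => by rw [← h, symmDiff_symmDiff_cancel_left],
    fun h => by rw [h, symmDiff_symmDiff_cancel_left]⟩

theorem symmDiff_symmDiff_eq_symmDiff {α : Type*} [GeneralizedBooleanAlgebra α] (a b c : α) :
    a ∆ b ∆ (b ∆ c) = a ∆ c := by
  rw [symmDiff_assoc, symmDiff_symmDiff_cancel_left]

theorem singleton_symmDiff_singleton {α : Type*} [DecidableEq α] {a b : α} (hab : a ≠ b) :
    ({a} : Finset α) ∆ {b} = {a, b} :=
  (Disjoint.symmDiff_eq_sup (Finset.disjoint_singleton.2 hab)).trans (Finset.insert_eq a {b}).symm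

theorem symmDiff_singleton_of_mem {α : Type*} [DecidableEq α] {a : α} {s : Finset α}
    (ha : a ∈ s) : s ∆ {a} = s.erase a := by
  grind [Finset.mem_symmDiff]

theorem symmDiff_singleton_of_notMem {α : Type*} [DecidableEq α] {a : α} {s : Finset α}
    (ha : a ∉ s) : s ∆ {a} = insert a s := by
  grind [Finset.mem_symmDiff]

theorem finset_subset_pair_iff {α : Type*} [DecidableEq α] {a b : α} {s : Finset α} :
    s ⊆ {a, b} ↔ s = ∅ ∨ s = {a} ∨ s = {b} ∨ s = {a, b} := by
  rw [← Finset.coe_subset, Finset.coe_pair, Set.subset_pair_iff_eq]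
  norm_cast

section Config

variable {E : Type*} [PartialOrder E] {R : E → E → Prop} {s t : Finset E}

/-- The finite configurations of a poset with a relation `R` of inconsistency: the finite lower
sets without inconsistent elements. Inconsistency need not be symmetric or irreflexive; an element
inconsistent with itself belongs to no configuration. -/
def IsConfig (R : E → E → Prop) (s : Finset E) : Prop :=
  IsLowerSet (s : Set E) ∧ ∀ a ∈ s, ∀ b ∈ s, ¬R a b

/-- The type of finite configurations, which are the vertices of a cube complex. -/
abbrev Config (R : E → E → Prop) := {s : Finset E // IsConfig R s}

theorem isConfig_empty : IsConfig R ∅ := by simp [IsConfig, isLowerSet_empty]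

instance : Nonempty (Config R) := ⟨⟨∅, isConfig_empty⟩⟩

theorem IsConfig.of_pairs
    (h : ∀ a b, ∃ t, IsConfig R t ∧ (a ∈ t ↔ a ∈ s) ∧ (b ∈ t ↔ b ∈ s)) : IsConfig R s := by
  refine ⟨fun a b hba ha => ?_, fun a ha b hb => ?_⟩ <;> obtain ⟨t, ht, hat, hbt⟩ := h a b
  · exact hbt.1 (ht.1 hba (hat.2 ha))
  · exact ht.2 a (hat.2 ha) b (hbt.2 hb)

variable [DecidableEq E]

theorem IsConfig.inter (hs : IsConfig R s) (ht : IsConfig R t) : IsConfig R (s ∩ t) := by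
  refine ⟨?_, fun a ha b hb => hs.2 a (Finset.mem_inter.1 ha).1 b (Finset.mem_inter.1 hb).1⟩
  rw [Finset.coe_inter]
  exact hs.1.inter ht.1

theorem IsConfig.erase {m : E} (hs : IsConfig R s) (hm : ∀ a ∈ s, ¬m < a) :
    IsConfig R (s.erase m) := by
  refine ⟨?_, fun a ha b hb => hs.2 a (Finset.mem_of_mem_erase ha) b (Finset.mem_of_mem_erase hb)⟩
  intro a b hba ha
  rw [Finset.mem_coe, Finset.mem_erase] at ha ⊢
  refine ⟨?_, hs.1 hba ha.2⟩
  rintro rfl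
  exact hm a ha.2 (lt_of_le_of_ne hba ha.1.symm)

namespace Config

variable {u v w : Config R} {a b : E} {F F' : Finset E}

/-- Every set obtained from the configuration `v` by flipping the membership of some elements of
`F` is a configuration. -/
def Spans (v : Config R) (F : Finset E) : Prop :=
  ∀ G ⊆ F, IsConfig R (v.1 ∆ G)

/-- The configurations that differ from `v` only in `F`. -/
def cube (v : Config R) (F : Finset E) : Set (Config R) :=
  {w | v.1 ∆ w.1 ⊆ F}

theorem Spans.mono (h : v.Spans F) (hF : F' ⊆ F) : v.Spans F' :=
  fun G hG => h G (hG.trans hF)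

theorem mem_cube_self : v ∈ v.cube F := by simp [cube]

theorem Spans.of_mem_cube (h : v.Spans F) (hw : w ∈ v.cube F) : w.Spans F := by
  intro G hG
  have : w.1 ∆ G = v.1 ∆ ((v.1 ∆ w.1) ∆ G) := by
    rw [← symmDiff_assoc, symmDiff_symmDiff_cancel_left]
  rw [this]
  exact h _ (Finset.symmDiff_subset_union.trans (Finset.union_subset hw hG))

theorem cube_eq_of_mem (hw : w ∈ v.cube F) : w.cube F = v.cube F := by
  ext x
  simp only [cube, Set.mem_ofPred_eq, Finset.subset_iff, Finset.mem_symmDiff] at hw ⊢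
  grind

theorem Spans.cube_subset_cube_iff (h : v.Spans F') : v.cube F' ⊆ v.cube F ↔ F' ⊆ F := by
  refine ⟨fun hsub a ha => ?_, fun hF w hw => Finset.Subset.trans hw hF⟩
  let flip : Config R := ⟨_, h {a} (by simpa using ha)⟩
  have flip_mem : flip ∈ v.cube F' := by simpa [cube, flip] using ha
  simpa [cube, flip] using hsub flip_mem

section Corner

variable {d : ℕ} {φ : Fin d ↪ E}

/-- The vertex with coordinates `x` of the cube spanned by `v` and the range of `φ`, coordinate `i`
telling whether the element `φ i` is flipped. -/
def Spans.corner (h : v.Spans (Finset.univ.map φ)) (x : Fin d → Bool) : Config R :=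
  ⟨v.1 ∆ Finset.map φ {i | x i = true}, h _ (Finset.map_subset_map.2 (Finset.subset_univ _))⟩

theorem Spans.corner_symmDiff_corner (h : v.Spans (Finset.univ.map φ)) (x y : Fin d → Bool) :
    (h.corner x).1 ∆ (h.corner y).1 = Finset.map φ {i | x i ≠ y i} := by
  rw [corner, corner, symmDiff_symmDiff_symmDiff_comm, symmDiff_self, bot_symmDiff]
  ext a
  simp only [Finset.mem_symmDiff, Finset.mem_map, Finset.mem_filter_univ]
  grind [φ.injective]

theorem Spans.corner_injective (h : v.Spans (Finset.univ.map φ)) :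
    Function.Injective h.corner := by
  intro x y hxy
  have := h.corner_symmDiff_corner x y
  rw [hxy, symmDiff_self, Finset.bot_eq_empty, eq_comm, Finset.map_eq_empty,
    Finset.filter_eq_empty_iff] at this
  funext i
  simpa using this (Finset.mem_univ i)

theorem Spans.range_corner (h : v.Spans (Finset.univ.map φ)) :
    Set.range h.corner = v.cube (Finset.univ.map φ) := by
  refine Set.Subset.antisymm ?_ fun w hw => ?_
  · rintro _ ⟨x, rfl⟩
    simp [cube, corner]
  · obtain ⟨K, -, hK⟩ := Finset.subset_map_iff.1 hw
    exact ⟨fun i => decide (i ∈ K), Subtype.ext (by simp [corner, ← hK])⟩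

theorem Spans.image_stdFace (h : v.Spans (Finset.univ.map φ)) (K : Finset (Fin d))
    (y : Fin d → Bool) :
    h.corner '' stdFace (K : Set (Fin d))ᶜ y = (h.corner y).cube (K.map φ) := by
  have corner_mem_iff (x) : h.corner x ∈ (h.corner y).cube (K.map φ) ↔ x ∈ stdFace (Kᶜ) y := by
    simp only [cube, stdFace, Set.mem_ofPred_eq, h.corner_symmDiff_corner, Finset.map_subset_map]
    grind
  refine Set.Subset.antisymm ?_ fun w hw => ?_
  · rintro _ ⟨x, hx, rfl⟩
    exact (corner_mem_iff x).2 hx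
  · have y_mem : h.corner y ∈ v.cube (Finset.univ.map φ) := h.range_corner.le ⟨y, rfl⟩
    have w_mem : w ∈ v.cube (Finset.univ.map φ) := by
      rw [← cube_eq_of_mem y_mem]
      exact Finset.Subset.trans hw (Finset.map_subset_map.2 (Finset.subset_univ _))
    obtain ⟨x, rfl⟩ := h.range_corner.ge w_mem
    exact ⟨x, (corner_mem_iff x).1 hw, rfl⟩

variable (R) in
/-- The vertex sets of the cubes of configurations. -/
def cubeSet : Set (Set (Config R)) :=
  {c | ∃ (v : Config R) (F : Finset E), v.Spans F ∧ c = v.cube F}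

theorem Spans.isCubeParam_corner (h : v.Spans (Finset.univ.map φ)) :
    IsCubeParam (cubeSet R) h.corner (v.cube (Finset.univ.map φ)) where
  injective := h.corner_injective
  range_eq := h.range_corner
  mem_iff s hs := by
    classical
    constructor
    · rintro ⟨z, F', hz, rfl⟩
      have z_mem := hs mem_cube_self
      rw [← cube_eq_of_mem z_mem, hz.cube_subset_cube_iff] at hs
      obtain ⟨y, rfl⟩ := h.range_corner.ge z_mem
      obtain ⟨K, -, rfl⟩ := Finset.subset_map_iff.1 hs
      exact ⟨_, y, (h.image_stdFace K y).symm⟩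
    · rintro ⟨S, y, rfl⟩
      have face_eq := h.image_stdFace Sᶜ.toFinset y
      rw [Set.coe_toFinset, compl_compl] at face_eq
      refine ⟨h.corner y, _, ?_, face_eq⟩
      exact (h.of_mem_cube (h.range_corner.le ⟨y, rfl⟩)).mono
        (Finset.map_subset_map.2 (Finset.subset_univ _))

end Corner

theorem Spans.exists_isCubeParam (h : v.Spans F) :
    ∃ e : (Fin F.card → Bool) → Config R, IsCubeParam (cubeSet R) e (v.cube F) := by
  obtain ⟨φ, hφ⟩ : ∃ φ : Fin F.card ↪ E, Finset.univ.map φ = F :=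
    ⟨F.equivFin.symm.toEmbedding.trans (Function.Embedding.subtype _), by
      rw [← Finset.map_map, Finset.map_univ_equiv]
      simp [Finset.ext_iff]⟩
  rw [← hφ] at h
  have := h.isCubeParam_corner
  rw [hφ] at this
  exact ⟨_, this⟩

variable (R) in
/-- The cube complex of configurations: a configuration and a set of elements that can be flipped
independently of one another span a cube. -/
def cubeComplex : CubeComplex (Config R) where
  cubes := cubeSet R
  singleton_mem v := by
    refine ⟨v, ∅, fun G hG => ?_, ?_⟩
    · rw [Finset.subset_empty.1 hG, ← Finset.bot_eq_empty, symmDiff_bot]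
      exact v.2
    · ext w
      simp [cube, Subtype.ext_iff, eq_comm]
  exists_param := by
    rintro _ ⟨v, F, h, rfl⟩
    exact ⟨_, h.exists_isCubeParam⟩
  inter_mem := by
    rintro _ ⟨v, F, h, rfl⟩ _ ⟨v', F', -, rfl⟩ ⟨z, hz, hz'⟩
    refine ⟨z, F ∩ F', (h.of_mem_cube hz).mono Finset.inter_subset_left, ?_⟩
    rw [← cube_eq_of_mem hz, ← cube_eq_of_mem hz']
    ext w
    simp [cube, Finset.subset_inter_iff]

theorem isCube_cubeComplex_iff {d : ℕ} {c : Set (Config R)} :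
    (cubeComplex R).IsCube d c ↔
      ∃ (v : Config R) (F : Finset E), v.Spans F ∧ F.card = d ∧ c = v.cube F := by
  constructor
  · rintro ⟨⟨v, F, h, rfl⟩, e, he⟩
    obtain ⟨e', he'⟩ := h.exists_isCubeParam
    refine ⟨v, F, h, ?_, rfl⟩
    have equiv := (Equiv.ofInjective e' he'.injective).trans
      ((Equiv.setCongr (he'.range_eq.trans he.range_eq.symm)).trans
        (Equiv.ofInjective e he.injective).symm)
    simpa using Fintype.card_congr equiv
  · rintro ⟨v, F, h, rfl, rfl⟩
    exact ⟨⟨v, F, h, rfl⟩, h.exists_isCubeParam⟩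

theorem spans_singleton (h : v.1 ∆ w.1 = {a}) : v.Spans {a} := by
  intro G hG
  obtain rfl | rfl := Finset.subset_singleton_iff.1 hG
  · rw [← Finset.bot_eq_empty, symmDiff_bot]
    exact v.2
  · rw [← symmDiff_eq_iff_eq_symmDiff.1 h]
    exact w.2

theorem cube_singleton (h : v.1 ∆ w.1 = {a}) : v.cube {a} = {v, w} := by
  ext x
  simp only [cube, ← h, Set.mem_ofPred_eq]
  rw [h, Finset.subset_singleton_iff, Finset.symmDiff_eq_empty, ← h, symmDiff_right_inj]
  simp [Subtype.ext_iff, eq_comm]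

theorem adj_iff : (cubeComplex R).skel.Adj v w ↔ ∃ a, v.1 ∆ w.1 = {a} := by
  constructor
  · rintro ⟨hne, z, F, h, hpair⟩
    have hv : v ∈ z.cube F := hpair ▸ Or.inl rfl
    rw [← cube_eq_of_mem hv] at hpair
    have hw : w ∈ v.cube F := hpair ▸ Or.inr rfl
    obtain ⟨a, ha⟩ : (v.1 ∆ w.1).Nonempty :=
      Finset.symmDiff_nonempty.2 fun h => hne (Subtype.ext h)
    let flip : Config R := ⟨_, h.of_mem_cube hv {a} (Finset.singleton_subset_iff.2 (hw ha))⟩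
    have flip_mem : flip ∈ v.cube F := by simpa [cube, flip] using hw ha
    rw [← hpair] at flip_mem
    obtain flip_eq | flip_eq := flip_mem
    · simp [flip, Subtype.ext_iff] at flip_eq
    · exact ⟨a, by simp [← Set.mem_singleton_iff.1 flip_eq, flip]⟩
  · rintro ⟨a, ha⟩
    exact ⟨fun h => by simp [h] at ha, v, {a}, spans_singleton ha, (cube_singleton ha).symm⟩

theorem spans_pair_iff :
    v.Spans {a, b} ↔
      IsConfig R (v.1 ∆ {a}) ∧ IsConfig R (v.1 ∆ {b}) ∧ IsConfig R (v.1 ∆ {a, b}) := by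
  refine ⟨fun h => ⟨h _ (by simp), h _ (by simp), h _ subset_rfl⟩, fun ⟨ha, hb, hab⟩ G hG => ?_⟩
  obtain rfl | rfl | rfl | rfl := finset_subset_pair_iff.1 hG
  · rw [← Finset.bot_eq_empty, symmDiff_bot]
    exact v.2
  exacts [ha, hb, hab]

theorem exists_of_isSquare {x : Config R} (h : (cubeComplex R).IsSquare u v w x) :
    ∃ a b, a ≠ b ∧ u.1 ∆ v.1 = {a} ∧ v.1 ∆ w.1 = {b} ∧ x.1 ∆ w.1 = {a} ∧ u.1 ∆ x.1 = {b} := by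
  obtain ⟨a, ha⟩ := adj_iff.1 h.ab
  obtain ⟨b, hb⟩ := adj_iff.1 h.bc
  obtain ⟨c, hc⟩ := adj_iff.1 h.cd.symm
  obtain ⟨d, hd⟩ := adj_iff.1 h.da.symm
  have diagonal : ({a} : Finset E) ∆ {b} = {d} ∆ {c} := by
    rw [← ha, ← hb, ← hc, ← hd, symmDiff_symmDiff_eq_symmDiff, symmDiff_symmDiff_eq_symmDiff]
  have a_ne_b : a ≠ b := by
    rintro rfl
    have : u.1 ∆ w.1 = ∅ := by
      rw [← symmDiff_symmDiff_eq_symmDiff _ v.1, ha, hb, symmDiff_self, Finset.bot_eq_empty]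
    exact h.ne_ac (Subtype.ext (Finset.symmDiff_eq_empty.1 this))
  have a_ne_d : a ≠ d := by
    rintro rfl
    exact h.ne_bd (Subtype.ext (symmDiff_right_injective u.1 (ha.trans hd.symm)))
  have : c = a ∧ d = b := by
    simp only [Finset.ext_iff, Finset.mem_symmDiff, Finset.mem_singleton] at diagonal
    grind only [diagonal a, diagonal b]
  obtain ⟨rfl, rfl⟩ := this
  exact ⟨c, d, a_ne_b, ha, hb, hc, hd⟩

theorem Spans.isSquare (h : u.Spans {a, b}) (hab : a ≠ b) {x : Config R}
    (hv : u.1 ∆ v.1 = {a}) (hw : u.1 ∆ w.1 = {a, b}) (hx : u.1 ∆ x.1 = {b}) :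
    (cubeComplex R).IsSquare u v w x := by
  rw [← singleton_symmDiff_singleton hab] at hw
  have hvw : v.1 ∆ w.1 = {b} := by
    rw [← symmDiff_symmDiff_eq_symmDiff _ u.1, symmDiff_comm v.1, hv, hw,
      symmDiff_symmDiff_cancel_left]
  have hwx : w.1 ∆ x.1 = {a} := by
    rw [← symmDiff_symmDiff_eq_symmDiff _ u.1, symmDiff_comm w.1, hw, hx,
      symmDiff_symmDiff_cancel_right]
  refine ⟨isCube_cubeComplex_iff.2 ⟨u, {a, b}, h, Finset.card_pair hab, ?_⟩,
    adj_iff.2 ⟨a, hv⟩, adj_iff.2 ⟨b, hvw⟩, adj_iff.2 ⟨a, hwx⟩, (adj_iff.2 ⟨b, hx⟩).symm⟩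
  ext y
  rw [cube, Set.mem_ofPred_eq, finset_subset_pair_iff, Finset.symmDiff_eq_empty,
    ← singleton_symmDiff_singleton hab, ← hw, ← hv, ← hx, symmDiff_right_inj, symmDiff_right_inj,
    symmDiff_right_inj]
  simp only [← Subtype.ext_iff, Set.mem_insert_iff, Set.mem_singleton_iff, eq_comm (b := y)]
  tauto

theorem mem_of_card_lt (h : v.1 ∆ w.1 = {a}) (hlt : w.1.card < v.1.card) :
    a ∈ v.1 ∧ w.1 = v.1.erase a := by
  rw [symmDiff_eq_iff_eq_symmDiff] at h
  have ha : a ∈ v.1 := by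
    by_contra ha
    rw [h, symmDiff_singleton_of_notMem ha, Finset.card_insert_of_notMem ha] at hlt
    omega
  exact ⟨ha, h.trans (symmDiff_singleton_of_mem ha)⟩

theorem isMorseRank_card :
    (cubeComplex R).IsMorseRank ⟨∅, isConfig_empty⟩ fun v => v.1.card where
  rank_root := Finset.card_empty
  rank_ne_of_adj v w hvw := by
    obtain ⟨a, ha⟩ := adj_iff.1 hvw
    rw [symmDiff_eq_iff_eq_symmDiff.1 ha]
    by_cases hav : a ∈ v.1
    · rw [symmDiff_singleton_of_mem hav]
      exact (Finset.card_erase_lt_of_mem hav).ne'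
    · rw [symmDiff_singleton_of_notMem hav, Finset.card_insert_of_notMem hav]
      exact (Nat.lt_succ_self _).ne
  exists_lower v hv := by
    have nonempty : v.1.Nonempty := Finset.nonempty_iff_ne_empty.2 fun h => hv (Subtype.ext h)
    obtain ⟨m, hm⟩ := v.1.exists_maximal nonempty
    refine ⟨⟨_, v.2.erase fun a ha => hm.not_gt ha⟩, adj_iff.2 ⟨m, ?_⟩,
      Finset.card_erase_lt_of_mem hm.1⟩
    rw [symmDiff_eq_iff_eq_symmDiff, symmDiff_singleton_of_mem hm.1]
  exists_square v u w hvu hvw hu hw huw := by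
    obtain ⟨a, ha⟩ := adj_iff.1 hvu
    obtain ⟨b, hb⟩ := adj_iff.1 hvw
    obtain ⟨hav, hua⟩ := mem_of_card_lt ha hu
    obtain ⟨hbv, hwb⟩ := mem_of_card_lt hb hw
    have hab : a ≠ b := fun h => huw (Subtype.ext (by rw [hua, hwb, h]))
    have inter_eq : u.1 ∩ w.1 = v.1 ∆ {a, b} := by
      rw [hua, hwb]
      grind [Finset.mem_symmDiff]
    have config := u.2.inter w.2
    refine ⟨⟨_, config⟩, Spans.isSquare (spans_pair_iff.2 ⟨?_, ?_, inter_eq ▸ config⟩) hab ha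
      (symmDiff_eq_iff_eq_symmDiff.2 inter_eq) hb, ?_, ?_⟩
    · exact symmDiff_eq_iff_eq_symmDiff.1 ha ▸ u.2
    · exact symmDiff_eq_iff_eq_symmDiff.1 hb ▸ w.2
    · exact Finset.card_lt_card ((Finset.ssubset_iff_of_subset Finset.inter_subset_left).2
        ⟨b, by simp [hua, hab.symm, hbv], by simp [hwb]⟩)
    · exact Finset.card_lt_card ((Finset.ssubset_iff_of_subset Finset.inter_subset_right).2
        ⟨a, by simp [hwb, hab, hav], by simp [hua]⟩)

theorem spans_of_pairs (h : ∀ a ∈ F, ∀ b ∈ F, IsConfig R (v.1 ∆ {a, b})) : v.Spans F := by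
  refine fun G hG => IsConfig.of_pairs fun a b => ⟨v.1 ∆ (G ∩ {a, b}), ?_,
    by grind [Finset.mem_symmDiff], by grind [Finset.mem_symmDiff]⟩
  by_cases ha : a ∈ G <;> by_cases hb : b ∈ G
  · rw [Finset.inter_eq_right.2 (by grind)]
    exact h a (hG ha) b (hG hb)
  · rw [show G ∩ {a, b} = {a, a} by grind]
    exact h a (hG ha) a (hG ha)
  · rw [show G ∩ {a, b} = {b, b} by grind]
    exact h b (hG hb) b (hG hb)
  · rw [show G ∩ {a, b} = ⊥ by grind, symmDiff_bot]
    exact v.2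

theorem isFlagLink (v : Config R) : (cubeComplex R).IsFlagLink v := by
  intro S hS hadj hpair
  let F := hS.toFinset.biUnion fun u => v.1 ∆ u.1
  have spans : v.Spans F := by
    refine spans_of_pairs fun a ha b hb => ?_
    obtain ⟨u, hu, hau⟩ := Finset.mem_biUnion.1 ha
    obtain ⟨w, hw, hbw⟩ := Finset.mem_biUnion.1 hb
    rw [Set.Finite.mem_toFinset] at hu hw
    obtain rfl | huw := eq_or_ne u w
    · obtain ⟨l, hl⟩ := adj_iff.1 (hadj u hu)
      rw [hl, Finset.mem_singleton] at hau hbw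
      rw [hau, hbw, Finset.pair_eq_singleton, ← symmDiff_eq_iff_eq_symmDiff.1 hl]
      exact u.2
    · obtain ⟨_, ⟨z, F', h, rfl⟩, hv, link_eq⟩ := hpair u hu w hw huw
      rw [← cube_eq_of_mem hv] at link_eq
      have hu' : u ∈ v.cube F' := (link_eq.le (Or.inl rfl)).1
      have hw' : w ∈ v.cube F' := (link_eq.le (Or.inr rfl)).1
      exact h.of_mem_cube hv _ (Finset.insert_subset (hu' hau)
        (Finset.singleton_subset_iff.2 (hw' hbw)))
  refine ⟨v.cube F, ⟨v, F, spans, rfl⟩, mem_cube_self, Set.ext fun w => ⟨fun hw => ?_, ?_⟩⟩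
  · exact ⟨Finset.subset_biUnion_of_mem (fun u : Config R => v.1 ∆ u.1) (hS.mem_toFinset.2 hw),
      hadj w hw⟩
  · rintro ⟨w_mem, hvw⟩
    obtain ⟨a, ha⟩ := adj_iff.1 hvw
    obtain ⟨u, hu, hau⟩ := Finset.mem_biUnion.1 (w_mem (ha ▸ Finset.mem_singleton_self a))
    rw [Set.Finite.mem_toFinset] at hu
    obtain ⟨b, hb⟩ := adj_iff.1 (hadj u hu)
    rw [hb, Finset.mem_singleton] at hau
    rwa [Subtype.ext (symmDiff_right_injective v.1 (ha.trans (hau ▸ hb.symm)))]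

theorem isCAT0_cubeComplex : (cubeComplex R).IsCAT0 :=
  ⟨isMorseRank_card.isSimplyConnected, isFlagLink⟩

theorem mem_of_lt (h : IsConfig R (v.1 ∆ {a})) (hba : b < a) : b ∈ v.1 := by
  by_cases ha : a ∈ v.1
  · exact v.2.1 hba.le ha
  · have hb : b ∈ v.1 ∆ {a} := h.1 hba.le (Finset.mem_coe.2 (by grind [Finset.mem_symmDiff]))
    simpa [Finset.mem_symmDiff, hba.ne] using hb

theorem notMem_of_lt (h : IsConfig R (v.1 ∆ {a})) (hab : a < b) : b ∉ v.1 := by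
  intro hb
  have hb' : b ∈ v.1 ∆ {a} := by simpa [Finset.mem_symmDiff, hab.ne'] using hb
  have ha : a ∈ v.1 := v.2.1 hab.le hb
  have ha' : a ∈ v.1 ∆ {a} := h.1 hab.le hb'
  simp [Finset.mem_symmDiff, ha] at ha'

theorem encard_neighborSet (v : Config R) : ((cubeComplex R).skel.neighborSet v).encard =
    {a | IsConfig R (v.1 ∆ {a})}.encard := by
  have flip_injective : Function.Injective fun a : E => v.1 ∆ {a} :=
    (symmDiff_right_injective v.1).comp Finset.singleton_injective
  rw [← Subtype.val_injective.encard_image, ← flip_injective.encard_image]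
  congr 1
  ext s
  simp only [Set.mem_image, SimpleGraph.mem_neighborSet, adj_iff, Set.mem_ofPred_eq,
    symmDiff_eq_iff_eq_symmDiff (a := v.1) (c := {_})]
  constructor
  · rintro ⟨w, ⟨a, hw⟩, rfl⟩
    exact ⟨a, hw ▸ w.2, hw.symm⟩
  · rintro ⟨a, ha, rfl⟩
    exact ⟨⟨_, ha⟩, ⟨a, rfl⟩, rfl⟩

theorem exists_label (e : (cubeComplex R).skel.edgeSet) :
    ∃ a, ∀ v w, (e : Sym2 (Config R)) = s(v, w) → v.1 ∆ w.1 = {a} := by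
  obtain ⟨⟨v, w⟩, hvw⟩ := e
  obtain ⟨a, ha⟩ := adj_iff.1 hvw
  refine ⟨a, fun v' w' h => ?_⟩
  obtain ⟨rfl, rfl⟩ | ⟨rfl, rfl⟩ := Sym2.eq_iff.1 h
  exacts [ha, symmDiff_comm v.1 w.1 ▸ ha]

/-- The element on which the two ends of an edge differ. -/
noncomputable def label (e : (cubeComplex R).skel.edgeSet) : E :=
  (exists_label e).choose

theorem label_eq {e : (cubeComplex R).skel.edgeSet} (he : e.1 = s(v, w)) (h : v.1 ∆ w.1 = {a}) :
    label e = a :=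
  Finset.singleton_injective (((exists_label e).choose_spec v w he).symm.trans h)

theorem label_eq_of_dualHyperplane_eq {e f : (cubeComplex R).skel.edgeSet}
    (h : (cubeComplex R).dualHyperplane e = (cubeComplex R).dualHyperplane f) :
    label e = label f := by
  refine congrArg (Quot.lift label ?_) h
  rintro e f ⟨v, w, x, y, hsq, he, hf⟩
  obtain ⟨a, b, -, hvw, -, hyx, -⟩ := exists_of_isSquare hsq
  rw [label_eq he hvw, label_eq hf hyx]

/-- The edge joining a configuration `v` to the configuration `insert a v`. -/
def upEdge (v : Config R) (ha : a ∉ v.1) (hav : IsConfig R (insert a v.1)) :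
    (cubeComplex R).skel.edgeSet :=
  ⟨s(v, ⟨_, hav⟩), adj_iff.2 ⟨a, by
    rw [symmDiff_eq_iff_eq_symmDiff, symmDiff_singleton_of_notMem ha]⟩⟩

theorem exists_eq_upEdge (e : (cubeComplex R).skel.edgeSet) :
    ∃ (v : Config R) (ha : label e ∉ v.1) (hav : IsConfig R (insert (label e) v.1)),
      e = upEdge v ha hav := by
  obtain ⟨⟨v, w⟩, hvw⟩ := e
  obtain ⟨a, ha⟩ := adj_iff.1 hvw
  simp only [label_eq (e := ⟨Quot.mk _ (v, w), hvw⟩) rfl ha]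
  rw [symmDiff_eq_iff_eq_symmDiff] at ha
  by_cases hav : a ∈ v.1
  · have insert_eq : insert a w.1 = v.1 := by
      rw [ha, symmDiff_singleton_of_mem hav, Finset.insert_erase hav]
    refine ⟨w, by grind [Finset.mem_symmDiff], insert_eq ▸ v.2, Subtype.ext ?_⟩
    simp only [upEdge, insert_eq]
    exact Sym2.eq_swap
  · rw [symmDiff_singleton_of_notMem hav] at ha
    refine ⟨v, hav, ha ▸ w.2, Subtype.ext ?_⟩
    simp only [upEdge, ← ha]

theorem dualHyperplane_upEdge_erase {m : E} (ha : a ∉ w.1) (haw : IsConfig R (insert a w.1))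
    (hm : m ∈ w.1) (hv : v.1 = w.1.erase m) (hav : IsConfig R (insert a v.1)) :
    (cubeComplex R).dualHyperplane (upEdge v (fun h => ha (by grind)) hav) =
      (cubeComplex R).dualHyperplane (upEdge w ha haw) := by
  have flip_a : v.1 ∆ {a} = insert a v.1 := by grind [Finset.mem_symmDiff]
  have flip_m : v.1 ∆ {m} = w.1 := by grind [Finset.mem_symmDiff]
  have flip_both : v.1 ∆ {a, m} = insert a w.1 := by grind [Finset.mem_symmDiff]
  have spans : v.Spans {a, m} :=
    spans_pair_iff.2 ⟨flip_a ▸ hav, flip_m ▸ w.2, flip_both ▸ haw⟩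
  exact Quot.sound ⟨v, ⟨_, hav⟩, ⟨_, haw⟩, w, spans.isSquare (by grind)
    (symmDiff_eq_iff_eq_symmDiff.2 flip_a.symm) (symmDiff_eq_iff_eq_symmDiff.2 flip_both.symm)
    (symmDiff_eq_iff_eq_symmDiff.2 flip_m.symm), rfl, rfl⟩

theorem dualHyperplane_upEdge_of_subset (hvw : v.1 ⊆ w.1) (ha : a ∉ w.1)
    (hav : IsConfig R (insert a v.1)) (haw : IsConfig R (insert a w.1)) :
    (cubeComplex R).dualHyperplane (upEdge v (fun h => ha (hvw h)) hav) =
      (cubeComplex R).dualHyperplane (upEdge w ha haw) := by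
  obtain ⟨w, hw⟩ := w
  induction w using Finset.strongInduction with
  | _ w ih =>
    obtain hempty | hne := (w \ v.1).eq_empty_or_nonempty
    · obtain rfl : v = ⟨w, hw⟩ :=
        Subtype.ext (hvw.antisymm (Finset.sdiff_eq_empty_iff_subset.1 hempty))
      rfl
    obtain ⟨m, hm⟩ := (w \ v.1).exists_maximal hne
    obtain ⟨hmw, hmv⟩ := Finset.mem_sdiff.1 hm.1
    have not_lt {b : E} (hb : b ∈ w) : ¬m < b := fun hmb =>
      hm.not_gt (Finset.mem_sdiff.2 ⟨hb, fun hbv => hmv (v.2.1 hmb.le hbv)⟩) hmb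
    have m_not_lt_a : ¬m < a := fun hma => by
      have := hav.1 hma.le (Finset.mem_insert_self a _)
      grind
    have erase_insert : (insert a w).erase m = insert a (w.erase m) := by grind
    have config : IsConfig R (insert a (w.erase m)) := by
      rw [← erase_insert]
      exact haw.erase fun b hb => (Finset.mem_insert.1 hb).elim (fun h => h ▸ m_not_lt_a) not_lt
    rw [← dualHyperplane_upEdge_erase (v := ⟨_, hw.erase fun b => not_lt⟩) ha haw hmw rfl config]
    exact ih _ (Finset.erase_ssubset hmw) _ (by grind) (by grind) config

theorem dualHyperplane_eq_iff {e f : (cubeComplex R).skel.edgeSet} :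
    (cubeComplex R).dualHyperplane e = (cubeComplex R).dualHyperplane f ↔ label e = label f := by
  refine ⟨label_eq_of_dualHyperplane_eq, fun h => ?_⟩
  obtain ⟨v, hav, hv, he⟩ := exists_eq_upEdge e
  obtain ⟨w, haw, hw, hf⟩ := exists_eq_upEdge f
  generalize label e = a, label f = b at *
  subst h
  rw [he, hf]
  have inter : IsConfig R (insert a (v.1 ∩ w.1)) := by
    rw [Finset.insert_inter_distrib]
    exact hv.inter hw
  have hvw := v.2.inter w.2
  rw [← dualHyperplane_upEdge_of_subset (v := ⟨_, hvw⟩) Finset.inter_subset_left hav inter hv,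
    ← dualHyperplane_upEdge_of_subset (v := ⟨_, hvw⟩) Finset.inter_subset_right haw inter hw]

theorem exists_coloring {C : Type*} [Nonempty C] (c : (cubeComplex R).crossingGraph.Coloring C) :
    ∃ γ : E → C, ∀ (v : Config R) (a b : E), a ≠ b → v.Spans {a, b} → γ a ≠ γ b := by
  let δ (e : (cubeComplex R).skel.edgeSet) : C := c ((cubeComplex R).dualHyperplane e)
  have factors : Function.FactorsThrough δ label :=
    fun e f h => congrArg c (dualHyperplane_eq_iff.2 h)
  refine ⟨Function.extend label δ fun _ => Classical.arbitrary C, fun v a b hab spans => ?_⟩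
  let va : Config R := ⟨_, (spans_pair_iff.1 spans).1⟩
  let vb : Config R := ⟨_, (spans_pair_iff.1 spans).2.1⟩
  let vab : Config R := ⟨_, spans _ subset_rfl⟩
  have square : (cubeComplex R).IsSquare v va vab vb :=
    spans.isSquare hab (by simp [va]) (by simp [vab]) (by simp [vb])
  obtain ⟨a', b', -, ha, hb, -, hb'⟩ := exists_of_isSquare square
  obtain rfl : a = a' := by simpa [va] using ha
  obtain rfl : b = b' := by simpa [vb] using hb'
  let ea : (cubeComplex R).skel.edgeSet := ⟨s(v, va), square.ab⟩
  let eb : (cubeComplex R).skel.edgeSet := ⟨s(va, vab), square.bc⟩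
  have label_ea : label ea = a := label_eq rfl ha
  have label_eb : label eb = b := label_eq rfl hb
  have hyperplane_ne :
      (cubeComplex R).dualHyperplane ea ≠ (cubeComplex R).dualHyperplane eb := by
    rwa [Ne, dualHyperplane_eq_iff, label_ea, label_eb]
  rw [← label_ea, ← label_eb, factors.extend_apply, factors.extend_apply]
  exact c.valid ⟨hyperplane_ne, v, va, vab, vb, square, rfl, rfl⟩

theorem Spans.exists_mem_iff (h : v.Spans F) {G : Finset E} (hG : G ⊆ F) :
    ∃ w : Config R, ∀ a ∈ F, a ∈ w.1 ↔ a ∈ G := by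
  refine ⟨⟨_, h ((v.1 ∩ F) ∆ G) ?_⟩, fun a ha => ?_⟩
  · grind [Finset.mem_symmDiff]
  · simp only
    grind [Finset.mem_symmDiff]

theorem Spans.not_lt (h : v.Spans F) (ha : a ∈ F) (hb : b ∈ F) : ¬a < b := by
  intro hab
  obtain ⟨w, hw⟩ := h.exists_mem_iff (G := {b}) (by simpa using hb)
  have : a ∈ w.1 := w.2.1 hab.le ((hw b hb).2 (Finset.mem_singleton_self b))
  exact hab.ne (Finset.mem_singleton.1 ((hw a ha).1 this))

theorem Spans.exists_superset (h : v.Spans F) : ∃ w : Config R, F ⊆ w.1 := by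
  obtain ⟨w, hw⟩ := h.exists_mem_iff subset_rfl
  exact ⟨w, fun a ha => (hw a ha).2 ha⟩

theorem spans_sdiff (hvw : v.1 ⊆ w.1) (h : ∀ a ∈ w.1 \ v.1, ∀ b < a, b ∈ v.1) :
    v.Spans (w.1 \ v.1) := by
  intro G hG
  have union_eq : v.1 ∆ G = v.1 ∪ G := Disjoint.symmDiff_eq_sup
    (Finset.disjoint_of_subset_right hG Finset.disjoint_sdiff)
  have union_sub : v.1 ∪ G ⊆ w.1 := Finset.union_subset hvw (hG.trans Finset.sdiff_subset)
  rw [union_eq]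
  refine ⟨fun a b hba ha => ?_, fun a ha b hb => w.2.2 a (union_sub ha) b (union_sub hb)⟩
  obtain rfl | hba := hba.eq_or_lt
  · exact ha
  obtain hav | haG := Finset.mem_union.1 ha
  · exact Finset.mem_union_left _ (v.2.1 hba.le hav)
  · exact Finset.mem_union_left _ (h a (hG haG) b hba)

end Config

end Config

/-- A box in the product of the path `ℕ` and of the binary tree of words ordered by prefixes: the
product of the interval `[left, right)` and of the subtree of the words that extend `top` and that
extend no word of `cut`. -/
structure Box where
  left : ℕ
  right : ℕ
  top : List Bool
  cut : Set (List Bool)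

namespace Box

/-- The word `t` lies in the subtree of the box. -/
def InTree (β : Box) (t : List Bool) : Prop :=
  β.top <+: t ∧ ∀ c ∈ β.cut, ¬c <+: t

/-- The point `(x, t)` lies in the box. -/
def Mem (β : Box) (x : ℕ) (t : List Bool) : Prop :=
  β.left ≤ x ∧ x < β.right ∧ β.InTree t

end Box

theorem encard_le_of_subset_finset {α : Type*} {s : Set α} {F : Finset α} {n : ℕ}
    (hsF : s ⊆ F) (hF : F.card ≤ n) : s.encard ≤ n :=
  (Set.encard_le_encard hsF).trans (by rw [Set.encard_coe_eq_coe_finsetCard]; exact_mod_cast hF)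

section Event

variable {ι : Type*} {β : ι → Box} {N : ℕ∞}

/-- The intersection graph of a family of boxes, restricted to the points `(x, t)` such that `x` and
the length of `t` are at most `N`. -/
def intersectionGraph (β : ι → Box) (N : ℕ∞) : SimpleGraph ι where
  Adj i j := i ≠ j ∧
    ∃ (x : ℕ) (t : List Bool), x ≤ N ∧ t.length ≤ N ∧ (β i).Mem x t ∧ (β j).Mem x t
  symm := ⟨fun _ _ ⟨hij, x, t, hx, ht, hi, hj⟩ => ⟨hij.symm, x, t, hx, ht, hj, hi⟩⟩
  loopless := ⟨fun _ h => h.1 rfl⟩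

/-- The events attached to a family of boxes: reaching a point of the path, reaching a node of the
tree, and entering a box. -/
inductive Event (β : ι → Box)
  | step (n : ℕ)
  | node (w : List Bool)
  | box (i : ι)

namespace Event

noncomputable instance : DecidableEq (Event β) := Classical.decEq _

/-- Causality: a point is reached after its ancestors, and a box is entered after its corner
`(left, top)`. -/
instance : PartialOrder (Event β) where
  le
    | step m, step n => m ≤ n
    | node w, node w' => w <+: w'
    | step n, box i => n ≤ (β i).left
    | node w, box i => w <+: (β i).top
    | box i, box j => i = j
    | _, _ => False
  le_refl
    | step n => le_refl n
    | node w => List.prefix_rfl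
    | box i => rfl
  le_trans := by
    rintro (l | u | i) (m | v | j) (n | w | k) hab hbc
    all_goals first
      | exact hab.elim
      | exact hbc.elim
      | exact le_trans hab hbc
      | exact List.IsPrefix.trans hab hbc
      | exact hbc ▸ hab
  le_antisymm := by
    rintro (m | v | i) (n | w | j) hab hba
    all_goals first
      | exact hab.elim
      | exact hba.elim
      | exact congrArg step (le_antisymm hab hba)
      | exact congrArg node (hab.eq_of_length_le (List.IsPrefix.length_le hba))
      | exact congrArg box hab

@[simp] theorem step_le_step {m n : ℕ} : (step m : Event β) ≤ step n ↔ m ≤ n := Iff.rfl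

@[simp] theorem node_le_node {v w : List Bool} : (node v : Event β) ≤ node w ↔ v <+: w := Iff.rfl

@[simp] theorem step_le_box {n : ℕ} {i : ι} : (step n : Event β) ≤ box i ↔ n ≤ (β i).left := Iff.rfl

@[simp] theorem node_le_box {w : List Bool} {i : ι} :
    (node w : Event β) ≤ box i ↔ w <+: (β i).top := Iff.rfl

@[simp] theorem step_lt_step {m n : ℕ} : (step m : Event β) < step n ↔ m < n := by
  rw [lt_iff_le_not_ge, step_le_step, step_le_step, ← lt_iff_le_not_ge]

theorem node_lt_node {v w : List Bool} : (node v : Event β) < node w ↔ v <+: w ∧ v ≠ w := by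
  rw [lt_iff_le_and_ne, node_le_node, Ne, Ne, Event.node.injEq]

/-- The pairs of events that do not occur together: branching nodes, a box and a point outside it.
Moreover the points and the nodes beyond the bound `N` do not occur at all, being inconsistent with
themselves. -/
inductive Inconsistent (N : ℕ∞) : Event β → Event β → Prop
  | node {v w : List Bool} : ¬v <+: w → ¬w <+: v → Inconsistent N (node v) (node w)
  | boxStep {i : ι} {n : ℕ} : (β i).right ≤ n → Inconsistent N (box i) (step n)
  | boxNode {i : ι} {c w : List Bool} : c ∈ (β i).cut → c <+: w →
      Inconsistent N (box i) (node w)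
  | stepBound {n : ℕ} : ¬(n : ℕ∞) ≤ N → Inconsistent N (step n) (step n)
  | nodeBound {w : List Bool} : ¬(w.length : ℕ∞) ≤ N → Inconsistent N (node w) (node w)

/-- The configurations of the events attached to a family of boxes. -/
abbrev BoxConfig (β : ι → Box) (N : ℕ∞) := Config (Inconsistent (β := β) N)

/-- The cube complex of the configurations of the events attached to a family of boxes. -/
noncomputable abbrev boxComplex (β : ι → Box) (N : ℕ∞) : CubeComplex (BoxConfig β N) :=
  Config.cubeComplex (Inconsistent N)

/-- The configuration `s` has reached exactly the point `(x, t)`. -/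
structure IsAt (s : Finset (Event β)) (x : ℕ) (t : List Bool) : Prop where
  step_mem_iff (n : ℕ) : step n ∈ s ↔ n ≤ x
  node_mem_iff (w : List Bool) : node w ∈ s ↔ w <+: t

variable {s : Finset (Event β)} {x : ℕ} {t : List Bool} {i : ι}

theorem exists_step_mem_iff (hs : IsConfig (Inconsistent N) s) {m : ℕ} (hm : step m ∈ s) :
    ∃ x, ∀ n, step n ∈ s ↔ n ≤ x := by
  have finite : {n | step n ∈ s}.Finite :=
    s.finite_toSet.preimage fun _ _ _ _ h => Event.step.inj h
  obtain ⟨x, hx, hmax⟩ := Set.exists_max_image _ id finite ⟨m, hm⟩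
  exact ⟨x, fun n => ⟨hmax n, fun h => hs.1 (step_le_step.2 h) hx⟩⟩

theorem exists_node_mem_iff (hs : IsConfig (Inconsistent N) s) {v : List Bool}
    (hv : node v ∈ s) : ∃ t, ∀ w, node w ∈ s ↔ w <+: t := by
  have finite : {w | node w ∈ s}.Finite :=
    s.finite_toSet.preimage fun _ _ _ _ h => Event.node.inj h
  obtain ⟨t, ht, hmax⟩ := Set.exists_max_image _ List.length finite ⟨v, hv⟩
  refine ⟨t, fun w => ⟨fun hw => ?_, fun h => hs.1 (node_le_node.2 h) ht⟩⟩
  by_contra hwt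
  have htw : ¬t <+: w := fun h => hwt (h.eq_of_length_le (hmax w hw) ▸ List.prefix_rfl)
  exact hs.2 _ hw _ ht (.node hwt htw)

theorem exists_isAt (hs : IsConfig (Inconsistent N) s) (hi : box i ∈ s) : ∃ x t, IsAt s x t := by
  obtain ⟨x, hx⟩ := exists_step_mem_iff hs (hs.1 (step_le_box.2 le_rfl) hi)
  obtain ⟨t, ht⟩ := exists_node_mem_iff hs (hs.1 (node_le_box.2 List.prefix_rfl) hi)
  exact ⟨x, t, hx, ht⟩

theorem IsAt.mem (h : IsAt s x t) (hs : IsConfig (Inconsistent N) s) (hi : box i ∈ s) :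
    (β i).Mem x t := by
  have hx : step x ∈ s := (h.step_mem_iff x).2 le_rfl
  have ht : node t ∈ s := (h.node_mem_iff t).2 List.prefix_rfl
  refine ⟨(h.step_mem_iff _).1 (hs.1 (step_le_box.2 le_rfl) hi), ?_,
    (h.node_mem_iff _).1 (hs.1 (node_le_box.2 List.prefix_rfl) hi), fun c hc hct => ?_⟩
  · by_contra hright
    exact hs.2 _ hi _ hx (.boxStep (not_lt.1 hright))
  · exact hs.2 _ hi _ ht (.boxNode hc hct)

theorem isAt_symmDiff_box : IsAt (s ∆ {box i}) x t ↔ IsAt s x t := by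
  refine ⟨fun ⟨hx, ht⟩ => ⟨fun n => ?_, fun w => ?_⟩, fun ⟨hx, ht⟩ => ⟨fun n => ?_, fun w => ?_⟩⟩
  · simpa [Finset.mem_symmDiff] using hx n
  · simpa [Finset.mem_symmDiff] using ht w
  · simpa [Finset.mem_symmDiff] using hx n
  · simpa [Finset.mem_symmDiff] using ht w

/-- The configuration that consists of the way to the point `(x, t)` and of the boxes in `J`. -/
noncomputable def point (x : ℕ) (t : List Bool) (J : Finset ι) : Finset (Event β) :=
  (Finset.range (x + 1)).image step ∪ t.inits.toFinset.image node ∪ J.image box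

section Point

variable {J : Finset ι}

@[simp] theorem step_mem_point {n : ℕ} : (step n : Event β) ∈ point x t J ↔ n ≤ x := by
  simp [point]

@[simp] theorem node_mem_point {w : List Bool} : (node w : Event β) ∈ point x t J ↔ w <+: t := by
  simp [point]

@[simp] theorem box_mem_point : (box i : Event β) ∈ point x t J ↔ i ∈ J := by
  simp [point]

theorem isConfig_point (hx : (x : ℕ∞) ≤ N) (ht : (t.length : ℕ∞) ≤ N)
    (hJ : ∀ i ∈ J, (β i).Mem x t) : IsConfig (Inconsistent (β := β) N) (point x t J) := by
  constructor
  · rintro (n | w | i) (m | v | j) hba ha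
    all_goals simp only [Finset.mem_coe, step_mem_point, node_mem_point, box_mem_point] at ha ⊢
    all_goals first
      | exact hba.elim
      | exact le_trans hba ha
      | exact List.IsPrefix.trans hba ha
      | exact le_trans hba (hJ _ ha).1
      | exact List.IsPrefix.trans hba (hJ _ ha).2.2.1
      | exact hba ▸ ha
  · rintro a ha b hb (⟨hvw, hwv⟩ | hright | ⟨hc, hcw⟩ | hn | hw)
    all_goals simp only [step_mem_point, node_mem_point, box_mem_point] at ha hb
    · exact (List.prefix_or_prefix_of_prefix ha hb).elim hvw hwv
    · exact absurd ((hright.trans hb).trans_lt (hJ _ ha).2.1) (lt_irrefl _)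
    · exact (hJ _ ha).2.2.2 _ hc (hcw.trans hb)
    · exact hn (le_trans (by exact_mod_cast ha) hx)
    · exact hw (le_trans (by exact_mod_cast ha.length_le) ht)

end Point

theorem colorable_intersectionGraph {n : ℕ} [NeZero n]
    (h : (boxComplex β N).crossingGraph.Colorable n) :
    (intersectionGraph β N).Colorable n := by
  classical
  obtain ⟨γ, hγ⟩ := Config.exists_coloring h.some
  refine ⟨.mk (fun i => γ (box i)) ?_⟩
  rintro i j ⟨hij, x, t, hx, ht, hi, hj⟩
  have isConfig (J : Finset ι) (hJ : ∀ k ∈ J, k = i ∨ k = j) :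
      IsConfig (Inconsistent (β := β) N) (point x t J) :=
    isConfig_point hx ht fun k hk => by obtain rfl | rfl := hJ k hk <;> assumption
  have flip (J : Finset ι) : (point x t J : Finset (Event β)) = point x t ∅ ∆ J.image box := by
    ext (n | w | k) <;> simp [Finset.mem_symmDiff]
  refine hγ ⟨_, isConfig ∅ (by simp)⟩ _ _ (by simpa using hij)
    (Config.spans_pair_iff.2 ⟨?_, ?_, ?_⟩)
  · rw [← Finset.image_singleton, ← flip]
    exact isConfig {i} (by simp)
  · rw [← Finset.image_singleton, ← flip]
    exact isConfig {j} (by simp)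
  · rw [← Finset.image_singleton, ← Finset.image_insert, ← flip]
    exact isConfig {i, j} (by simp)

theorem encard_le (A : Set (Event β)) :
    A.encard ≤ (step ⁻¹' A).encard + (node ⁻¹' A).encard + (box ⁻¹' A).encard := by
  have union_eq : A = step '' (step ⁻¹' A) ∪ node '' (node ⁻¹' A) ∪ box '' (box ⁻¹' A) := by
    ext (n | w | i) <;> simp
  calc A.encard
      _ ≤ (step '' (step ⁻¹' A)).encard + (node '' (node ⁻¹' A)).encard +
          (box '' (box ⁻¹' A)).encard := by
        conv_lhs => rw [union_eq]
        exact (Set.encard_union_le _ _).trans (by gcongr; exact Set.encard_union_le _ _)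
      _ ≤ _ := by gcongr <;> exact Set.encard_image_le _ _

section Degree

variable (v : BoxConfig β N)

theorem encard_step_flip_le : {n | IsConfig (Inconsistent N) (v.1 ∆ {step n})}.encard ≤ 2 := by
  by_cases hm : ∃ m, step m ∈ v.1
  · obtain ⟨m, hm⟩ := hm
    obtain ⟨x, hx⟩ := exists_step_mem_iff v.2 hm
    refine encard_le_of_subset_finset (F := {x, x + 1}) (fun n hn => ?_) Finset.card_le_two
    have le_of_lt (k : ℕ) (hk : k < n) : k ≤ x :=
      (hx k).1 (Config.mem_of_lt hn (step_lt_step.2 hk))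
    have not_lt : ¬n < x := fun h =>
      Config.notMem_of_lt hn (step_lt_step.2 h) ((hx x).2 le_rfl)
    have := le_of_lt (n - 1)
    simp only [Finset.coe_pair, Set.mem_insert_iff, Set.mem_singleton_iff]
    omega
  · refine encard_le_of_subset_finset (F := {0}) (fun n hn => ?_) (by simp)
    by_contra h
    rw [Finset.coe_singleton, Set.mem_singleton_iff] at h
    exact hm ⟨0, Config.mem_of_lt hn (step_lt_step.2 (Nat.pos_of_ne_zero h))⟩

theorem eq_or_eq_append_of_node_flip {t w : List Bool} (ht : ∀ u, node u ∈ v.1 ↔ u <+: t)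
    (hw : IsConfig (Inconsistent N) (v.1 ∆ {node w})) : w = t ∨ ∃ b, w = t ++ [b] := by
  have t_mem : node t ∈ v.1 := (ht t).2 List.prefix_rfl
  by_contra! h
  have not_prefix : ¬w <+: t := fun hwt =>
    Config.notMem_of_lt hw (node_lt_node.2 ⟨hwt, h.1⟩) t_mem
  obtain ⟨r, rfl⟩ : t <+: w := by
    by_contra htw
    exact hw.2 (node w) (by grind [Finset.mem_symmDiff]) (node t) (by grind [Finset.mem_symmDiff])
      (.node not_prefix htw)
  obtain _ | ⟨b, _ | ⟨c, r⟩⟩ := r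
  · simp at h
  · simp at h
  · have child_mem : node (t ++ [b]) ∈ v.1 :=
      Config.mem_of_lt hw (node_lt_node.2 ⟨⟨c :: r, by simp⟩, by simp⟩)
    simpa using ((ht _).1 child_mem).length_le

theorem encard_node_flip_le : {w | IsConfig (Inconsistent N) (v.1 ∆ {node w})}.encard ≤ 3 := by
  by_cases hu : ∃ u, node u ∈ v.1
  · obtain ⟨u, hu⟩ := hu
    obtain ⟨t, ht⟩ := exists_node_mem_iff v.2 hu
    refine encard_le_of_subset_finset (F := {t, t ++ [true], t ++ [false]}) (fun w hw => ?_)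
      Finset.card_le_three
    obtain rfl | ⟨_ | _, rfl⟩ := eq_or_eq_append_of_node_flip v ht hw <;> simp
  · refine encard_le_of_subset_finset (F := {[]}) (fun w hw => ?_) (by simp)
    by_contra h
    rw [Finset.coe_singleton, Set.mem_singleton_iff] at h
    exact hu ⟨[], Config.mem_of_lt hw (node_lt_node.2 ⟨List.nil_prefix, Ne.symm h⟩)⟩

theorem exists_isAt_of_box_flip (hi : IsConfig (Inconsistent N) (v.1 ∆ {box i})) :
    ∃ x t, IsAt v.1 x t := by
  by_cases hiv : box i ∈ v.1
  · exact exists_isAt v.2 hiv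
  · simpa only [isAt_symmDiff_box] using exists_isAt hi (i := i) (by grind [Finset.mem_symmDiff])

theorem IsAt.mem_of_flip (h : IsAt v.1 x t) (hi : IsConfig (Inconsistent N) (v.1 ∆ {box i})) :
    (β i).Mem x t := by
  by_cases hiv : box i ∈ v.1
  · exact h.mem v.2 hiv
  · exact (isAt_symmDiff_box.2 h).mem hi (i := i) (by grind [Finset.mem_symmDiff])

theorem encard_box_flip_le {k : ℕ∞} (hβ : ∀ x t, {i | (β i).Mem x t}.encard ≤ k) :
    {i | IsConfig (Inconsistent N) (v.1 ∆ {box i})}.encard ≤ k := by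
  obtain hempty | ⟨i, hi⟩ := {i | IsConfig (Inconsistent N) (v.1 ∆ {box i})}.eq_empty_or_nonempty
  · simp [hempty]
  · obtain ⟨x, t, h⟩ := exists_isAt_of_box_flip v hi
    exact (Set.encard_le_encard fun j hj => h.mem_of_flip v hj).trans (hβ x t)

theorem encard_neighborSet_le {k : ℕ∞} (hβ : ∀ x t, {i | (β i).Mem x t}.encard ≤ k) :
    ((boxComplex β N).skel.neighborSet v).encard ≤ 5 + k := by
  rw [Config.encard_neighborSet]
  calc _ ≤ _ := encard_le _
    _ ≤ 2 + 3 + k := by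
      gcongr
      exacts [encard_step_flip_le v, encard_node_flip_le v, encard_box_flip_le v hβ]
    _ = 5 + k := by norm_num

end Degree

theorem card_le_of_spans {v : BoxConfig β N} {F : Finset (Event β)} (h : v.Spans F) {k : ℕ∞}
    (hβ : ∀ x t, {i | (β i).Mem x t}.encard ≤ k) : (F.card : ℕ∞) ≤ 2 + k := by
  obtain ⟨w, hw⟩ := h.exists_superset
  have step_le : (step ⁻¹' (F : Set (Event β))).encard ≤ 1 := by
    rw [Set.encard_le_one_iff_subsingleton]
    intro m hm n hn
    exact le_antisymm (not_lt.1 fun hlt => h.not_lt hn hm (step_lt_step.2 hlt))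
      (not_lt.1 fun hlt => h.not_lt hm hn (step_lt_step.2 hlt))
  have node_le : (node ⁻¹' (F : Set (Event β))).encard ≤ 1 := by
    rw [Set.encard_le_one_iff_subsingleton]
    intro t ht u hu
    by_contra htu
    exact w.2.2 _ (hw ht) _ (hw hu) (.node
      (fun hle => h.not_lt ht hu (node_lt_node.2 ⟨hle, htu⟩))
      fun hle => h.not_lt hu ht (node_lt_node.2 ⟨hle, Ne.symm htu⟩))
  have box_le : (box ⁻¹' (F : Set (Event β))).encard ≤ k := by
    obtain hempty | ⟨i, hi⟩ := (box ⁻¹' (F : Set (Event β))).eq_empty_or_nonempty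
    · simp [hempty]
    · obtain ⟨x, t, hxt⟩ := exists_isAt w.2 (hw hi)
      exact (Set.encard_le_encard fun j hj => hxt.mem w.2 (hw hj)).trans (hβ x t)
  calc (F.card : ℕ∞) = (F : Set (Event β)).encard := (Set.encard_coe_eq_coe_finsetCard F).symm
    _ ≤ _ := encard_le _
    _ ≤ 1 + 1 + k := by gcongr
    _ = 2 + k := by norm_num

theorem exists_isCube {J : Finset ι} {b : Bool} (h₀ : ∀ i ∈ J, (β i).Mem x t)
    (h₁ : ∀ i ∈ J, (β i).Mem (x + 1) (t ++ [b])) :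
    ∃ c, (boxComplex β ⊤).IsCube (J.card + 2) c := by
  let v : BoxConfig β ⊤ := ⟨point x t ∅, isConfig_point le_top le_top (by simp)⟩
  let w : BoxConfig β ⊤ := ⟨point (x + 1) (t ++ [b]) J, isConfig_point le_top le_top h₁⟩
  have hvw : v.1 ⊆ w.1 := by
    rintro (n | u | i) h
    · exact step_mem_point.2 ((step_mem_point.1 h).trans x.le_succ)
    · exact node_mem_point.2 ((node_mem_point.1 h).trans (List.prefix_append _ _))
    · simp [v] at h
  have sdiff_eq : w.1 \ v.1 = insert (step (x + 1)) (insert (node (t ++ [b])) (J.image box)) := by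
    ext (n | u | i)
    · simp only [v, w, Finset.mem_sdiff, Finset.mem_insert, Finset.mem_image, step_mem_point,
        Event.step.injEq, reduceCtorEq, and_false, exists_false, or_false]
      omega
    · have not_prefix : ¬t ++ [b] <+: t := fun h => by simpa using h.length_le
      simp only [v, w, Finset.mem_sdiff, Finset.mem_insert, Finset.mem_image, node_mem_point,
        List.prefix_concat_iff, Event.node.injEq, reduceCtorEq, and_false, exists_false, or_false,
        false_or]
      grind
    · simp [v, w]
  have card_eq : (w.1 \ v.1).card = J.card + 2 := by
    rw [sdiff_eq, Finset.card_insert_of_notMem (by simp), Finset.card_insert_of_notMem (by simp),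
      Finset.card_image_of_injective _ fun _ _ h => Event.box.inj h]
  have mem_of_lt : ∀ a ∈ w.1 \ v.1, ∀ c < a, c ∈ v.1 := by
    simp only [sdiff_eq, Finset.forall_mem_insert, Finset.forall_mem_image]
    refine ⟨?_, ?_, fun i hi => ?_⟩ <;> rintro (n | u | j) hlt
    · exact step_mem_point.2 (Nat.le_of_lt_succ (step_lt_step.1 hlt))
    · exact hlt.le.elim
    · exact hlt.le.elim
    · exact hlt.le.elim
    · obtain ⟨hle, hne⟩ := node_lt_node.1 hlt
      exact node_mem_point.2 ((List.prefix_concat_iff.1 hle).resolve_left hne)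
    · exact hlt.le.elim
    · exact step_mem_point.2 ((step_le_box.1 hlt.le).trans (h₀ i hi).1)
    · exact node_mem_point.2 ((node_le_box.1 hlt.le).trans (h₀ i hi).2.2.1)
    · exact absurd (congrArg box hlt.le) hlt.ne
  exact ⟨_, Config.isCube_cubeComplex_iff.2 ⟨v, _, Config.spans_sdiff hvw mem_of_lt, card_eq, rfl⟩⟩

theorem hasDim_boxComplex {J : Finset ι} {b : Bool}
    (hβ : ∀ x t, {i | (β i).Mem x t}.encard ≤ J.card) (h₀ : ∀ i ∈ J, (β i).Mem x t)
    (h₁ : ∀ i ∈ J, (β i).Mem (x + 1) (t ++ [b])) : (boxComplex β ⊤).HasDim (J.card + 2) := by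
  refine ⟨exists_isCube h₀ h₁, ?_⟩
  rintro _ ⟨_, hc⟩
  obtain ⟨v, F, hF, rfl, -⟩ := Config.isCube_cubeComplex_iff.1 hc
  rw [add_comm]
  exact_mod_cast card_le_of_spans hF hβ

theorem finite_boxConfig (hβ : ∀ m : ℕ, {i | (β i).top.length ≤ m}.Finite) (N : ℕ) :
    Finite (BoxConfig β N) := by
  let A : Set (Event β) := step '' {n | n ≤ N} ∪ node '' {w | w.length ≤ N} ∪
    box '' {i | (β i).top.length ≤ N}
  have finite : A.Finite := (((Set.finite_le_nat N).image _).union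
    ((List.finite_length_le Bool N).image _)).union ((hβ N).image _)
  have length_le (v : BoxConfig β N) (w : List Bool) (hw : node w ∈ v.1) : w.length ≤ N := by
    by_contra h
    exact v.2.2 _ hw _ hw (.nodeBound (by exact_mod_cast h))
  have subset (v : BoxConfig β N) : (v.1 : Set (Event β)) ⊆ A := by
    rintro (n | w | i) h
    · refine .inl (.inl ⟨n, ?_, rfl⟩)
      by_contra hn
      exact v.2.2 _ h _ h (.stepBound (by exact_mod_cast hn))
    · exact .inl (.inr ⟨w, length_le v w h, rfl⟩)
    · exact .inr ⟨i, length_le v _ (v.2.1 (node_le_box.2 List.prefix_rfl) h), rfl⟩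
  have := finite.finite_subsets.to_subtype
  exact .of_injective (fun v : BoxConfig β N => (⟨v.1, subset v⟩ : {B | B ⊆ A})) fun v w h =>
    Subtype.ext (Finset.coe_injective (congrArg Subtype.val h))

theorem infinite_boxConfig : Infinite (BoxConfig β ⊤) := by
  refine .of_injective (fun n : ℕ => (⟨point n [] ∅, isConfig_point le_top le_top (by simp)⟩ :
    BoxConfig β ⊤)) fun m n h => ?_
  have step_mem_iff (k : ℕ) : k ≤ m ↔ k ≤ n := by
    simpa using congrArg (fun v : BoxConfig β ⊤ => step k ∈ v.1) h
  exact le_antisymm ((step_mem_iff m).1 le_rfl) ((step_mem_iff n).2 le_rfl)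

end Event

end Event

namespace Box

variable {β : Box} {w t : List Bool} {x a m : ℕ} {A : Set (List Bool)}

/-- The box obtained by grafting the tree of `β` at the word `w`. -/
def graft (w : List Bool) (β : Box) : Box :=
  { β with top := w ++ β.top, cut := (w ++ ·) '' β.cut }

/-- The box obtained by translating the interval of `β`. -/
def shift (a : ℕ) (β : Box) : Box :=
  { β with left := a + β.left, right := a + β.right }

/-- The box obtained by replacing each point of the path by `m` points. -/
def stretch (m : ℕ) (β : Box) : Box :=
  { β with left := β.left * m, right := β.right * m }

/-- The box obtained by removing the words that extend a word of `A`. -/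
def prune (A : Set (List Bool)) (β : Box) : Box :=
  { β with cut := β.cut ∪ A }

theorem inTree_graft_append : (β.graft w).InTree (w ++ t) ↔ β.InTree t := by
  simp only [InTree, graft, List.prefix_append_right_inj, Set.forall_mem_image]

theorem inTree_graft : (β.graft w).InTree t ↔ ∃ t', t = w ++ t' ∧ β.InTree t' := by
  constructor
  · intro h
    obtain ⟨t', rfl⟩ := (List.prefix_append _ _).trans h.1
    exact ⟨t', rfl, inTree_graft_append.1 h⟩
  · rintro ⟨t', rfl, h⟩
    exact inTree_graft_append.2 h

theorem inTree_prune : (β.prune A).InTree t ↔ β.InTree t ∧ ∀ c ∈ A, ¬c <+: t := by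
  simp only [InTree, prune, Set.mem_union, or_imp, forall_and, and_assoc]

theorem mem_prune : (β.prune A).Mem x t ↔ β.Mem x t ∧ ∀ c ∈ A, ¬c <+: t := by
  simp only [Mem, inTree_prune, and_assoc]
  rfl

theorem mem_graft : (β.graft w).Mem x t ↔ ∃ t', t = w ++ t' ∧ β.Mem x t' := by
  simp only [Mem, inTree_graft]
  exact ⟨fun ⟨hl, hr, t', ht, h⟩ => ⟨t', ht, hl, hr, h⟩, fun ⟨t', ht, hl, hr, h⟩ =>
    ⟨hl, hr, t', ht, h⟩⟩

theorem mem_shift : (β.shift a).Mem x t ↔ a ≤ x ∧ β.Mem (x - a) t := by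
  simp only [Mem, shift, InTree]
  grind

theorem mem_stretch (hm : 0 < m) : (β.stretch m).Mem x t ↔ β.Mem (x / m) t := by
  simp only [Mem, InTree, stretch, Nat.le_div_iff_mul_le hm, Nat.div_lt_iff_lt_mul hm]

end Box

theorem intersectionGraph_mono {ι : Type*} (β : ι → Box) : Monotone (intersectionGraph β) := by
  rintro M N hMN i j ⟨hij, x, t, hx, ht, h⟩
  exact ⟨hij, x, t, hx.trans hMN, ht.trans hMN, h⟩

theorem intersectionGraph_top_adj {ι : Type*} {β : ι → Box} {i j : ι} :
    (intersectionGraph β ⊤).Adj i j ↔ i ≠ j ∧ ∃ x t, (β i).Mem x t ∧ (β j).Mem x t := by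
  simp only [intersectionGraph, le_top, true_and]

/-- The homomorphism of intersection graphs given by an injection that keeps boxes with a common
point in such a position. -/
def intersectionGraphHom {ι κ : Type*} {α : ι → Box} {β : κ → Box} (f : ι → κ)
    (hf : f.Injective) (h : ∀ i j x t, (α i).Mem x t → (α j).Mem x t →
      ∃ x t, (β (f i)).Mem x t ∧ (β (f j)).Mem x t) :
    intersectionGraph α ⊤ →g intersectionGraph β ⊤ where
  toFun := f
  map_rel' hij := by
    obtain ⟨hne, x, t, hi, hj⟩ := intersectionGraph_top_adj.1 hij
    exact intersectionGraph_top_adj.2 ⟨hf.ne hne, h _ _ x t hi hj⟩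

/-- A finite system of boxes with probes, as in Burling's construction. The probe `p` is the
horizontal ray that starts at the point `(pos p, word p)`. The subtrees of the boxes do not branch
above `word p`, the start of the probe lies in no box, and the boxes that the probe meets are
pairwise disjoint along it. -/
structure BoxSystem : Type 1 where
  ι : Type
  P : Type
  finite_ι : Finite ι
  finite_P : Finite P
  box : ι → Box
  width : ℕ
  pos : P → ℕ
  word : P → List Bool
  width_pos : 0 < width
  right_le : ∀ i, (box i).right ≤ width
  pos_lt : ∀ p, pos p + 1 < width
  eq_of_prefix : ∀ p q, word p <+: word q → p = q
  inTree_append : ∀ i p w, (box i).InTree (word p ++ w) ↔ (box i).InTree (word p)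
  not_mem_start : ∀ i p, ¬(box i).Mem (pos p) (word p)
  eq_of_mem_probe : ∀ p x, pos p ≤ x → ∀ i j, (box i).Mem x (word p) → (box j).Mem x (word p) →
    i = j
  encard_le : ∀ x t, {i | (box i).Mem x t}.encard ≤ 2

namespace BoxSystem

variable {S T : BoxSystem}

/-- The boxes that a probe enters. -/
def through (S : BoxSystem) (p : S.P) : Set S.ι :=
  {i | (S.box i).InTree (S.word p) ∧ S.pos p < (S.box i).left ∧ (S.box i).left < (S.box i).right}

/-- In every proper colouring of the boxes some probe enters boxes of at least `k` colours. -/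
def Forces (S : BoxSystem) (k : ℕ) : Prop :=
  ∀ (C : Type) (γ : (intersectionGraph S.box ⊤).Coloring C),
    ∃ p, (k : ℕ∞) ≤ (γ '' S.through p).encard

theorem eq_of_prefix_of_prefix {p q : S.P} {t : List Bool} (hp : S.word p <+: t)
    (hq : S.word q <+: t) : p = q :=
  (List.prefix_or_prefix_of_prefix hp hq).elim (S.eq_of_prefix _ _)
    fun h => (S.eq_of_prefix _ _ h).symm

theorem eq_of_word_append_eq {p q : S.P} {t u : List Bool}
    (h : S.word p ++ t = S.word q ++ u) : p = q ∧ t = u := by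
  obtain rfl := S.eq_of_prefix_of_prefix (h ▸ List.prefix_append _ _) (List.prefix_append _ _)
  exact ⟨rfl, List.append_cancel_left h⟩

theorem word_append_prefix_iff {p q : S.P} {t u : List Bool} :
    S.word p ++ t <+: S.word q ++ u ↔ p = q ∧ t <+: u := by
  constructor
  · rintro ⟨v, hv⟩
    rw [List.append_assoc] at hv
    obtain ⟨rfl, rfl⟩ := eq_of_word_append_eq hv
    exact ⟨rfl, List.prefix_append _ _⟩
  · rintro ⟨rfl, h⟩
    exact (List.prefix_append_right_inj _).2 h

theorem word_prefix_iff {p q : S.P} {t : List Bool} : S.word p <+: S.word q ++ t ↔ p = q := by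
  simpa using word_append_prefix_iff (p := p) (q := q) (t := []) (u := t)

theorem not_prefix_word {p q : S.P} {b : Bool} : ¬S.word p ++ [b] <+: S.word q := by
  simpa using word_append_prefix_iff (p := p) (q := q) (t := [b]) (u := []).not

theorem mem_append_iff {i : S.ι} {p : S.P} {x : ℕ} {t : List Bool} :
    (S.box i).Mem x (S.word p ++ t) ↔ (S.box i).Mem x (S.word p) := by
  simp only [Box.Mem, S.inTree_append]

/-- The system without boxes and with a single probe. -/
def base : BoxSystem where
  ι := Empty
  P := Unit
  finite_ι := inferInstance
  finite_P := inferInstance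
  box := Empty.elim
  width := 2
  pos _ := 0
  word _ := []
  width_pos := two_pos
  right_le i := i.elim
  pos_lt _ := one_lt_two
  eq_of_prefix _ _ _ := rfl
  inTree_append i := i.elim
  not_mem_start i := i.elim
  eq_of_mem_probe _ _ _ i := i.elim
  encard_le x t := by simp only [Set.eq_empty_of_isEmpty, Set.encard_empty, zero_le]

section Split

/-- The boxes of the system `split S`. -/
def splitBox (S : BoxSystem) : S.ι ⊕ S.P → Box
  | .inl i => (S.box i).prune (Set.range fun q => S.word q ++ [false])
  | .inr q => ⟨S.pos q + 1, S.width, S.word q, {S.word q ++ [true]}⟩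

variable {i : S.ι} {q q' : S.P} {b : Bool} {x : ℕ} {t : List Bool}

theorem inTree_splitBox_inl : (S.splitBox (.inl i)).InTree (S.word q ++ b :: t) ↔
    (S.box i).InTree (S.word q) ∧ b = true := by
  simp only [splitBox, Box.inTree_prune, S.inTree_append, Set.forall_mem_range,
    word_append_prefix_iff]
  simp

theorem inTree_splitBox_inr : (S.splitBox (.inr q')).InTree (S.word q ++ b :: t) ↔
    q' = q ∧ b = false := by
  simp only [splitBox, Box.InTree, Set.mem_singleton_iff, forall_eq, word_append_prefix_iff,
    word_prefix_iff]
  simp +contextual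

theorem encard_splitBox_le (S : BoxSystem) (x : ℕ) (t : List Bool) :
    {j | (S.splitBox j).Mem x t}.encard ≤ 2 := by
  by_cases hq : ∃ q, S.word q <+: t ∧ S.pos q < x
  · obtain ⟨q, ⟨t, rfl⟩, hx⟩ := hq
    have hsub : {j | (S.splitBox j).Mem x (S.word q ++ t)} ⊆
        insert (.inr q) (.inl '' {i | (S.box i).Mem x (S.word q)}) := by
      rintro (i | q') hj
      · exact .inr ⟨i, mem_append_iff.1 (Box.mem_prune.1 hj).1, rfl⟩
      · exact .inl (congrArg _ (word_prefix_iff.1 hj.2.2.1))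
    have hone : {i | (S.box i).Mem x (S.word q)}.encard ≤ 1 :=
      Set.encard_le_one_iff.2 (S.eq_of_mem_probe q x hx.le)
    calc _ ≤ ((.inl : _ → S.ι ⊕ S.P) '' {i | (S.box i).Mem x (S.word q)}).encard + 1 :=
          (Set.encard_le_encard hsub).trans (Set.encard_insert_le _ _)
      _ ≤ 1 + 1 := by gcongr; exact (Set.encard_image_le _ _).trans hone
      _ = 2 := one_add_one_eq_two
  · have hsub : {j | (S.splitBox j).Mem x t} ⊆ .inl '' {i | (S.box i).Mem x t} := by
      rintro (i | q') hj
      · exact ⟨i, (Box.mem_prune.1 hj).1, rfl⟩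
      · exact absurd ⟨q', hj.2.2.1, hj.1⟩ hq
    exact (Set.encard_le_encard hsub).trans ((Set.encard_image_le _ _).trans (S.encard_le x t))

/-- The system with a new box to the right of the start of each probe. The probe is doubled, one
copy passing through the old boxes only and the other one through the new box only. -/
def split (S : BoxSystem) : BoxSystem where
  ι := S.ι ⊕ S.P
  P := S.P × Bool
  finite_ι :=
    have := S.finite_ι
    have := S.finite_P
    inferInstance
  finite_P :=
    have := S.finite_P
    inferInstance
  box := S.splitBox
  width := S.width
  pos p := S.pos p.1
  word p := S.word p.1 ++ [p.2]
  width_pos := S.width_pos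
  right_le := by
    rintro (i | q)
    exacts [S.right_le i, le_rfl]
  pos_lt p := S.pos_lt p.1
  eq_of_prefix := by
    rintro ⟨p, a⟩ ⟨q, b⟩ h
    obtain ⟨rfl : p = q, hab : [a] <+: [b]⟩ := word_append_prefix_iff.1 h
    exact congrArg _ (List.singleton_inj.1 (hab.eq_of_length_le le_rfl))
  inTree_append := by
    rintro (i | q') ⟨q, b⟩ w <;> rw [List.append_assoc, List.singleton_append]
    · exact inTree_splitBox_inl.trans inTree_splitBox_inl.symm
    · exact inTree_splitBox_inr.trans inTree_splitBox_inr.symm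
  not_mem_start := by
    rintro (i | q') ⟨q, b⟩ h
    · exact S.not_mem_start i q ⟨h.1, h.2.1, (inTree_splitBox_inl.1 h.2.2).1⟩
    · obtain ⟨rfl, -⟩ := inTree_splitBox_inr.1 h.2.2
      exact Nat.not_succ_le_self _ h.1
  eq_of_mem_probe := by
    rintro ⟨q, b⟩ x hx (i | q₁) (j | q₂) hi hj
    · exact congrArg _ (S.eq_of_mem_probe q x hx i j
        (mem_append_iff.1 (Box.mem_prune.1 hi).1) (mem_append_iff.1 (Box.mem_prune.1 hj).1))
    · exact nomatch (inTree_splitBox_inl.1 hi.2.2).2.symm.trans (inTree_splitBox_inr.1 hj.2.2).2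
    · exact nomatch (inTree_splitBox_inl.1 hj.2.2).2.symm.trans (inTree_splitBox_inr.1 hi.2.2).2
    · rw [(inTree_splitBox_inr.1 hi.2.2).1, (inTree_splitBox_inr.1 hj.2.2).1]
  encard_le := S.encard_splitBox_le

/-- The copy of the boxes of `S` in `split S`. -/
def splitHom (S : BoxSystem) : intersectionGraph S.box ⊤ →g intersectionGraph S.split.box ⊤ :=
  intersectionGraphHom .inl Sum.inl_injective fun i j x t hi hj => by
    by_cases h : ∃ q, S.word q ++ [false] <+: t
    · -- The new boxes cut off `t`, but `i` and `j` already meet above, at the word of the probe.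
      obtain ⟨q, hq⟩ := h
      obtain ⟨t, rfl⟩ := (List.prefix_append _ _).trans hq
      refine ⟨x, S.word q, Box.mem_prune.2 ⟨mem_append_iff.1 hi, ?_⟩,
        Box.mem_prune.2 ⟨mem_append_iff.1 hj, ?_⟩⟩ <;>
      exact Set.forall_mem_range.2 fun _ => not_prefix_word
    · have hcut : ∀ c ∈ Set.range fun q => S.word q ++ [false], ¬c <+: t :=
        Set.forall_mem_range.2 (not_exists.1 h)
      exact ⟨x, t, Box.mem_prune.2 ⟨hi, hcut⟩, Box.mem_prune.2 ⟨hj, hcut⟩⟩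

theorem inl_mem_through_split (hi : i ∈ S.through q) :
    (Sum.inl i : S.split.ι) ∈ S.split.through (q, true) :=
  ⟨inTree_splitBox_inl.2 ⟨hi.1, rfl⟩, hi.2⟩

theorem inr_mem_through_split : (Sum.inr q : S.split.ι) ∈ S.split.through (q, false) :=
  ⟨inTree_splitBox_inr.2 ⟨rfl, rfl⟩, Nat.lt_succ_self _, S.pos_lt q⟩

theorem split_adj (hi : i ∈ S.through q) :
    (intersectionGraph S.split.box ⊤).Adj (.inl i) (.inr q) :=
  intersectionGraph_top_adj.2 ⟨Sum.inl_ne_inr, (S.box i).left, S.word q,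
    Box.mem_prune.2 ⟨⟨le_rfl, hi.2.2, hi.1⟩, Set.forall_mem_range.2 fun _ => not_prefix_word⟩,
    hi.2.1, hi.2.2.trans_le (S.right_le i), List.prefix_rfl,
    fun _ hc => hc ▸ not_prefix_word⟩

end Split

section Nest

/-- The boxes of the system `nest S T`. -/
def nestBox (S T : BoxSystem) : S.ι ⊕ S.P × T.ι → Box
  | .inl i => (S.box i).stretch T.width
  | .inr (p, j) => ((T.box j).shift (S.pos p * T.width)).graft (S.word p)

variable {i : S.ι} {j : T.ι} {p p' : S.P} {q : T.P} {x : ℕ} {t : List Bool}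

theorem mem_nestBox_inl :
    (S.nestBox T (.inl i)).Mem x t ↔ (S.box i).Mem (x / T.width) t :=
  Box.mem_stretch T.width_pos

theorem mem_nestBox_inr_append : (S.nestBox T (.inr (p', j))).Mem x (S.word p ++ t) ↔
    p' = p ∧ S.pos p * T.width ≤ x ∧ (T.box j).Mem (x - S.pos p * T.width) t := by
  simp only [nestBox, Box.mem_graft, Box.mem_shift]
  constructor
  · rintro ⟨t', h, hx, hm⟩
    obtain ⟨rfl, rfl⟩ := eq_of_word_append_eq h
    exact ⟨rfl, hx, hm⟩
  · rintro ⟨rfl, hx, hm⟩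
    exact ⟨t, rfl, hx, hm⟩

theorem mem_nestBox_inr_add : (S.nestBox T (.inr (p, j))).Mem (S.pos p * T.width + x)
    (S.word p ++ t) ↔ (T.box j).Mem x t := by
  simp only [mem_nestBox_inr_append, true_and, Nat.le_add_right, Nat.add_sub_cancel_left]

theorem inTree_nestBox_inr_append : (S.nestBox T (.inr (p', j))).InTree (S.word p ++ t) ↔
    p' = p ∧ (T.box j).InTree t := by
  simp only [nestBox, Box.inTree_graft]
  constructor
  · rintro ⟨t', h, hm⟩
    obtain ⟨rfl, rfl⟩ := eq_of_word_append_eq h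
    exact ⟨rfl, hm⟩
  · rintro ⟨rfl, hm⟩
    exact ⟨t, rfl, hm⟩

theorem mul_width_add_div {a b : ℕ} (hb : b < T.width) : (a * T.width + b) / T.width = a := by
  rw [mul_comm, Nat.mul_add_div T.width_pos, Nat.div_eq_of_lt hb, add_zero]

theorem div_eq_pos_of_mem (h : (S.nestBox T (.inr (p, j))).Mem x (S.word p ++ t)) :
    x / T.width = S.pos p := by
  obtain ⟨-, hx, hm⟩ := mem_nestBox_inr_append.1 h
  rw [← Nat.add_sub_of_le hx, mul_width_add_div (hm.2.1.trans_le (T.right_le j))]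

theorem window_of_mem (h : (S.nestBox T (.inr (p, j))).Mem x t) :
    S.word p <+: t ∧ x / T.width = S.pos p := by
  obtain ⟨t, rfl⟩ := (List.prefix_append _ _).trans h.2.2.1
  exact ⟨List.prefix_append _ _, div_eq_pos_of_mem h⟩

theorem not_mem_nestBox_inl (hx : x / T.width = S.pos p) :
    ¬(S.nestBox T (.inl i)).Mem x (S.word p ++ t) := by
  rw [mem_nestBox_inl, hx, mem_append_iff]
  exact S.not_mem_start i p

theorem encard_nestBox_le (S T : BoxSystem) (x : ℕ) (t : List Bool) :
    {j | (S.nestBox T j).Mem x t}.encard ≤ 2 := by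
  by_cases hp : ∃ p, S.word p <+: t ∧ x / T.width = S.pos p
  · obtain ⟨p, ⟨t, rfl⟩, hx⟩ := hp
    have hsub : {j | (S.nestBox T j).Mem x (S.word p ++ t)} ⊆
        (fun j => .inr (p, j)) '' {j | (T.box j).Mem (x - S.pos p * T.width) t} := by
      rintro (i | ⟨p', j⟩) hj
      · exact absurd hj (not_mem_nestBox_inl hx)
      · obtain ⟨rfl, -, hj⟩ := mem_nestBox_inr_append.1 hj
        exact ⟨j, hj, rfl⟩
    exact (Set.encard_le_encard hsub).trans ((Set.encard_image_le _ _).trans (T.encard_le _ _))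
  · have hsub : {j | (S.nestBox T j).Mem x t} ⊆ .inl '' {i | (S.box i).Mem (x / T.width) t} := by
      rintro (i | ⟨p, j⟩) hj
      · exact ⟨i, mem_nestBox_inl.1 hj, rfl⟩
      · exact absurd ⟨p, window_of_mem hj⟩ hp
    exact (Set.encard_le_encard hsub).trans ((Set.encard_image_le _ _).trans (S.encard_le _ _))

theorem pos_mul_width_add_le (S T : BoxSystem) (p : S.P) :
    S.pos p * T.width + T.width ≤ S.width * T.width := by
  rw [← Nat.succ_mul]
  exact Nat.mul_le_mul_right _ (Nat.le_of_succ_le (S.pos_lt p))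

/-- The system `S`, stretched so that a copy of `T` fits at the start of each probe. -/
def nest (S T : BoxSystem) : BoxSystem where
  ι := S.ι ⊕ S.P × T.ι
  P := S.P × T.P
  finite_ι :=
    have := S.finite_ι
    have := S.finite_P
    have := T.finite_ι
    inferInstance
  finite_P :=
    have := S.finite_P
    have := T.finite_P
    inferInstance
  box := S.nestBox T
  width := S.width * T.width
  pos p := S.pos p.1 * T.width + T.pos p.2
  word p := S.word p.1 ++ T.word p.2
  width_pos := Nat.mul_pos S.width_pos T.width_pos
  right_le := by
    rintro (i | ⟨p, j⟩)
    · exact Nat.mul_le_mul_right _ (S.right_le i)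
    · exact (Nat.add_le_add_left (T.right_le j) _).trans (S.pos_mul_width_add_le T p)
  pos_lt p := (Nat.add_lt_add_left (T.pos_lt p.2) _).trans_le (S.pos_mul_width_add_le T p.1)
  eq_of_prefix := by
    rintro ⟨p, q⟩ ⟨p', q'⟩ h
    obtain ⟨rfl : p = p', hq⟩ := word_append_prefix_iff.1 h
    exact congrArg _ (T.eq_of_prefix _ _ hq)
  inTree_append := by
    rintro (i | ⟨p', j⟩) ⟨p, q⟩ w <;> rw [List.append_assoc]
    · exact (S.inTree_append i p _).trans (S.inTree_append i p _).symm
    · rw [inTree_nestBox_inr_append, inTree_nestBox_inr_append, T.inTree_append]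
  not_mem_start := by
    rintro (i | ⟨p', j⟩) ⟨p, q⟩ h
    · exact not_mem_nestBox_inl (mul_width_add_div (Nat.lt_of_succ_lt (T.pos_lt q))) h
    · obtain ⟨rfl : p' = p, -⟩ := mem_nestBox_inr_append.1 h
      exact T.not_mem_start j q (mem_nestBox_inr_add.1 h)
  eq_of_mem_probe := by
    rintro ⟨p, q⟩ x (hx : S.pos p * T.width + T.pos q ≤ x) (i | ⟨p₁, i⟩) (j | ⟨p₂, j⟩) hi hj
    · have hxp : S.pos p ≤ x / T.width :=
        (Nat.le_div_iff_mul_le T.width_pos).2 (Nat.le_of_add_right_le hx)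
      exact congrArg _ (S.eq_of_mem_probe p _ hxp i j (mem_append_iff.1 (mem_nestBox_inl.1 hi))
        (mem_append_iff.1 (mem_nestBox_inl.1 hj)))
    · obtain ⟨rfl : p₂ = p, -⟩ := mem_nestBox_inr_append.1 hj
      exact absurd hi (not_mem_nestBox_inl (div_eq_pos_of_mem hj))
    · obtain ⟨rfl : p₁ = p, -⟩ := mem_nestBox_inr_append.1 hi
      exact absurd hj (not_mem_nestBox_inl (div_eq_pos_of_mem hi))
    · obtain ⟨rfl : p₁ = p, -, hi⟩ := mem_nestBox_inr_append.1 hi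
      obtain ⟨rfl : p₂ = p₁, -, hj⟩ := mem_nestBox_inr_append.1 hj
      rw [T.eq_of_mem_probe q _ (Nat.le_sub_of_add_le' hx) i j hi hj]
  encard_le := S.encard_nestBox_le T

/-- The copy of the boxes of `S` in `nest S T`. -/
def nestHomInl (S T : BoxSystem) :
    intersectionGraph S.box ⊤ →g intersectionGraph (S.nest T).box ⊤ :=
  intersectionGraphHom .inl Sum.inl_injective fun i j x t hi hj =>
    ⟨x * T.width, t, mem_nestBox_inl.2 (by rwa [Nat.mul_div_cancel _ T.width_pos]),
      mem_nestBox_inl.2 (by rwa [Nat.mul_div_cancel _ T.width_pos])⟩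

/-- The copy of the boxes of `T` in `nest S T` at the probe `p`. -/
def nestHomInr (S T : BoxSystem) (p : S.P) :
    intersectionGraph T.box ⊤ →g intersectionGraph (S.nest T).box ⊤ :=
  intersectionGraphHom (fun j => .inr (p, j))
    (Sum.inr_injective.comp (Prod.mk_right_injective p)) fun _ _ x t hi hj =>
      ⟨S.pos p * T.width + x, S.word p ++ t, mem_nestBox_inr_add.2 hi, mem_nestBox_inr_add.2 hj⟩

theorem inl_mem_through_nest (hi : i ∈ S.through p) (q : T.P) :
    (Sum.inl i : (S.nest T).ι) ∈ (S.nest T).through (p, q) := by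
  obtain ⟨htree, hpos, hlt⟩ := hi
  refine ⟨(S.inTree_append i p _).2 htree, ?_, Nat.mul_lt_mul_of_pos_right hlt T.width_pos⟩
  calc S.pos p * T.width + T.pos q < S.pos p * T.width + T.width :=
        Nat.add_lt_add_left (Nat.lt_of_succ_lt (T.pos_lt q)) _
    _ = (S.pos p + 1) * T.width := (Nat.succ_mul _ _).symm
    _ ≤ (S.box i).left * T.width := Nat.mul_le_mul_right _ hpos

theorem inr_mem_through_nest (p : S.P) (hj : j ∈ T.through q) :
    (Sum.inr (p, j) : (S.nest T).ι) ∈ (S.nest T).through (p, q) :=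
  ⟨inTree_nestBox_inr_append.2 ⟨rfl, hj.1⟩, Nat.add_lt_add_left hj.2.1 _,
    Nat.add_lt_add_left hj.2.2 _⟩

end Nest

theorem Forces.split {k : ℕ} (hS : S.Forces k) {C : Type}
    (γ : (intersectionGraph S.split.box ⊤).Coloring C) :
    ∃ q, (k : ℕ∞) ≤ ((γ ∘ S.splitHom) '' S.through q).encard ∧
      γ (.inr q) ∉ (γ ∘ S.splitHom) '' S.through q := by
  obtain ⟨q, hq⟩ := hS C (γ.comp S.splitHom)
  refine ⟨q, hq, ?_⟩
  rintro ⟨i, hi, heq⟩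
  exact γ.valid (split_adj hi) heq

theorem add_one_le_encard_union_or_insert {α : Type*} {A B : Set α} {a : α} {k : ℕ∞}
    (hA : k ≤ A.encard) (hB : k ≤ B.encard) (ha : a ∉ A) :
    k + 1 ≤ (B ∪ A).encard ∨ k + 1 ≤ (insert a B).encard := by
  by_cases hAB : A ⊆ B
  · right
    calc k + 1 ≤ A.encard + 1 := by gcongr
      _ = (insert a A).encard := (Set.encard_insert_of_notMem ha).symm
      _ ≤ (insert a B).encard := Set.encard_le_encard (Set.insert_subset_insert hAB)
  · left
    obtain ⟨b, hbA, hbB⟩ := Set.not_subset.1 hAB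
    calc k + 1 ≤ B.encard + 1 := by gcongr
      _ = (insert b B).encard := (Set.encard_insert_of_notMem hbB).symm
      _ ≤ (B ∪ A).encard :=
        Set.encard_le_encard (Set.insert_subset (.inr hbA) Set.subset_union_left)

theorem Forces.nest_split {k : ℕ} (hS : S.Forces k) : (S.nest S.split).Forces (k + 1) := by
  intro C γ
  obtain ⟨p, hp⟩ := hS C (γ.comp (S.nestHomInl S.split))
  obtain ⟨q, hq, hnew⟩ := hS.split (γ.comp (S.nestHomInr S.split p))
  have houter : ∀ b, (γ ∘ S.nestHomInl S.split) '' S.through p ⊆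
      γ '' (S.nest S.split).through (p, q, b) := by
    rintro b _ ⟨i, hi, rfl⟩
    exact ⟨_, inl_mem_through_nest hi _, rfl⟩
  rw [Nat.cast_add_one]
  rcases add_one_le_encard_union_or_insert hq hp hnew with h | h
  · refine ⟨(p, q, true), h.trans (Set.encard_le_encard (Set.union_subset (houter true) ?_))⟩
    rintro _ ⟨i, hi, rfl⟩
    exact ⟨_, inr_mem_through_nest p (inl_mem_through_split hi), rfl⟩
  · refine ⟨(p, q, false), h.trans (Set.encard_le_encard (Set.insert_subset ?_ (houter false)))⟩
    exact ⟨_, inr_mem_through_nest p inr_mem_through_split, rfl⟩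

/-- The systems of Burling's construction. -/
def burling : ℕ → BoxSystem
  | 0 => base
  | k + 1 => (burling k).nest (burling k).split

theorem forces_burling : ∀ k, (burling k).Forces k
  | 0 => fun _ _ => ⟨(), by simp only [Nat.cast_zero, zero_le]⟩
  | k + 1 => (forces_burling k).nest_split

theorem Forces.not_colorable {k n : ℕ} (hS : S.Forces k) (hn : n < k) :
    ¬(intersectionGraph S.box ⊤).Colorable n := by
  rintro ⟨γ⟩
  obtain ⟨p, hp⟩ := hS (Fin n) γ
  have hcard : (γ '' S.through p).encard ≤ n := by
    simpa using Set.encard_le_encard (Set.subset_univ (γ '' S.through p))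
  exact hn.not_ge (by exact_mod_cast hp.trans hcard)

end BoxSystem

section Branch

/-- The words `1ᵏ0`, no two of which have a common extension. -/
def branch (k : ℕ) : List Bool := List.replicate k true ++ [false]

theorem eq_of_branch_prefix {k l : ℕ} {t : List Bool} (hk : branch k <+: t)
    (hl : branch l <+: t) : k = l := by
  induction k generalizing l t with
  | zero =>
    obtain ⟨t, rfl⟩ := hk
    cases l with
    | zero => rfl
    | succ l => simp [branch, List.replicate_succ] at hl
  | succ k ih =>
    obtain ⟨t, rfl⟩ := hk
    cases l with
    | zero => simp [branch, List.replicate_succ] at hl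
    | succ l =>
      simp only [branch, List.replicate_succ, List.cons_append, List.cons_prefix_cons,
        true_and] at hl
      rw [ih (List.prefix_append _ _) hl]

variable {ι : ℕ → Type*} {β : ∀ k, ι k → Box}

/-- The union of a sequence of families of boxes, separated from each other by grafting them at
the words `branch k`. -/
def branchUnion (β : ∀ k, ι k → Box) (i : Σ k, ι k) : Box :=
  (β i.1 i.2).graft (branch i.1)

theorem encard_branchUnion_le {m : ℕ∞} (hβ : ∀ k x t, {i | (β k i).Mem x t}.encard ≤ m) (x : ℕ)
    (t : List Bool) : {i | (branchUnion β i).Mem x t}.encard ≤ m := by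
  obtain hempty | ⟨⟨k, i⟩, hi⟩ := {i | (branchUnion β i).Mem x t}.eq_empty_or_nonempty
  · simp [hempty]
  · obtain ⟨t, rfl, -⟩ := Box.mem_graft.1 hi
    have hsub : {i | (branchUnion β i).Mem x (branch k ++ t)} ⊆
        Sigma.mk k '' {i | (β k i).Mem x t} := by
      rintro ⟨l, j⟩ hj
      obtain ⟨u, hu, hj⟩ := Box.mem_graft.1 hj
      obtain rfl : k = l := eq_of_branch_prefix (List.prefix_append _ _) ⟨u, hu.symm⟩
      obtain rfl := List.append_cancel_left hu
      exact ⟨j, hj, rfl⟩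
    exact (Set.encard_le_encard hsub).trans ((Set.encard_image_le _ _).trans (hβ k x t))

theorem finite_top_length_le [∀ k, Finite (ι k)] (m : ℕ) :
    {i | (branchUnion β i).top.length ≤ m}.Finite := by
  refine ((Set.finite_lt_nat m).biUnion fun k _ => Set.finite_range (Sigma.mk k)).subset ?_
  rintro ⟨k, i⟩ (hi : (branch k ++ (β k i).top).length ≤ m)
  refine Set.mem_biUnion (?_ : k < m) ⟨i, rfl⟩
  simp only [branch, List.length_append, List.length_replicate, List.length_singleton] at hi
  omega

/-- The copy of the family `β k` in the union. -/
def branchUnionHom (β : ∀ k, ι k → Box) (k : ℕ) :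
    intersectionGraph (β k) ⊤ →g intersectionGraph (branchUnion β) ⊤ :=
  intersectionGraphHom (Sigma.mk k) sigma_mk_injective fun _ _ x t hi hj =>
    ⟨x, branch k ++ t, Box.mem_graft.2 ⟨t, rfl, hi⟩, Box.mem_graft.2 ⟨t, rfl, hj⟩⟩

end Branch

theorem exists_nat_intersectionGraph_adj {ι : Type*} {β : ι → Box} {i j : ι}
    (h : (intersectionGraph β ⊤).Adj i j) : ∃ N : ℕ, (intersectionGraph β N).Adj i j := by
  obtain ⟨hij, x, t, -, -, h⟩ := h
  exact ⟨max x t.length, hij, x, t, by exact_mod_cast le_max_left _ _,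
    by exact_mod_cast le_max_right _ _, h⟩

theorem exists_nat_forall_not_colorable {ι κ : Type*} [Finite κ] {H : SimpleGraph κ}
    {β : ι → Box} (f : H →g intersectionGraph β ⊤) {n : ℕ} (hH : ¬H.Colorable n) :
    ∃ N : ℕ, ∀ M : ℕ∞, N ≤ M → ¬(intersectionGraph β M).Colorable n := by
  have hadj (e : κ × κ) : ∃ N : ℕ, H.Adj e.1 e.2 → (intersectionGraph β N).Adj (f e.1) (f e.2) := by
    by_cases he : H.Adj e.1 e.2
    · exact (exists_nat_intersectionGraph_adj (f.map_rel he)).imp fun _ h _ => h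
    · exact ⟨0, fun h => absurd h he⟩
  choose N hN using hadj
  obtain ⟨N₀, hN₀⟩ := Finite.exists_le N
  refine ⟨N₀, fun M hM hc => hH (hc.of_hom ⟨f, fun {i j} hij => ?_⟩)⟩
  exact intersectionGraph_mono β (le_trans (by exact_mod_cast hN₀ (i, j)) hM) (hN (i, j) hij)

section BurlingBoxes

open BoxSystem

/-- The index types of the families `burlingFamily`. -/
def BurlingIndex : ℕ → Type
  | 0 => Fin 3
  | k + 1 => (burling k).ι

instance : ∀ k, Finite (BurlingIndex k)
  | 0 => inferInstanceAs (Finite (Fin 3))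
  | k + 1 => (burling k).finite_ι

/-- Burling's families of boxes, preceded by three equal boxes, which give rise to a `5`-cube. -/
def burlingFamily : ∀ k, BurlingIndex k → Box
  | 0, _ => ⟨0, 2, [], ∅⟩
  | k + 1, i => (burling k).box i

theorem encard_burlingFamily_le : ∀ k x t, {i | (burlingFamily k i).Mem x t}.encard ≤ 3
  | 0, _, _ => encard_le_of_subset_finset (F := (Finset.univ : Finset (Fin 3)))
      (fun _ _ => Finset.mem_coe.2 (Finset.mem_univ _)) le_rfl
  | k + 1, x, t => ((burling k).encard_le x t).trans (by norm_num)

/-- The boxes of all of Burling's families, together with three boxes that give rise to a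
`5`-cube. -/
def burlingBoxes : (Σ k, BurlingIndex k) → Box := branchUnion burlingFamily

theorem encard_burlingBoxes_le (x : ℕ) (t : List Bool) :
    {i | (burlingBoxes i).Mem x t}.encard ≤ 3 :=
  encard_branchUnion_le encard_burlingFamily_le x t

theorem hasDim_boxComplex_burlingBoxes : (Event.boxComplex burlingBoxes ⊤).HasDim 5 := by
  let J : Finset (Σ k, BurlingIndex k) :=
    (Finset.univ : Finset (Fin 3)).map ⟨fun i => ⟨0, i⟩, sigma_mk_injective⟩
  have hJ (x : ℕ) (hx : x < 2) (t : List Bool) :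
      ∀ i ∈ J, (burlingBoxes i).Mem x (branch 0 ++ t) := by
    intro i hi
    obtain ⟨i, -, rfl⟩ := Finset.mem_map.1 hi
    exact Box.mem_graft.2 ⟨t, rfl, Nat.zero_le x, hx, List.nil_prefix, fun _ h => h.elim⟩
  exact Event.hasDim_boxComplex (J := J) (b := true) encard_burlingBoxes_le (hJ 0 two_pos [])
    (hJ 1 one_lt_two [true])

theorem exists_nat_forall_not_colorable_crossingGraph (n : ℕ) : ∃ N : ℕ, ∀ M : ℕ∞, N ≤ M →
    ¬(Event.boxComplex burlingBoxes M).crossingGraph.Colorable n := by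
  have : Finite (burling (n + 2)).ι := (burling _).finite_ι
  obtain ⟨N, hN⟩ := exists_nat_forall_not_colorable (branchUnionHom burlingFamily (n + 3))
    ((forces_burling (n + 2)).not_colorable (Nat.lt_succ_self (n + 1)))
  exact ⟨N, fun M hM hc => hN M hM (Event.colorable_intersectionGraph (hc.mono n.le_succ))⟩

theorem exists_hasMaxDegree_burlingBoxes (N : ℕ∞) :
    ∃ D ≤ 8, (Event.boxComplex burlingBoxes N).HasMaxDegree D :=
  CubeComplex.exists_hasMaxDegree fun v =>
    (Event.encard_neighborSet_le v encard_burlingBoxes_le).trans (by norm_num)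

end BurlingBoxes

theorem CubeComplex.lt_chromaticNumber_and_lt {V : Type v} {X : CubeComplex V} {n : ℕ}
    (h : ¬X.crossingGraph.Colorable n) : (n : ℕ∞) < X.crossingGraph.chromaticNumber ∧
      ∀ k : ℕ, EmbedsInTrees.{v, w} X k → n < k :=
  ⟨not_le.1 fun hle => h (SimpleGraph.chromaticNumber_le_iff_colorable.1 hle),
    fun _ hk => not_le.1 fun hle => h (hk.colorable.mono hle)⟩

theorem exists_forall_exists_ge_of_forall_exists_le {P : ℕ → ℕ → Prop} {B : ℕ}
    (h : ∀ m, ∃ D ≤ B, P m D) : ∃ D, ∀ n, ∃ m ≥ n, P m D := by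
  choose d hd hP using h
  obtain ⟨D, hD⟩ := Finite.exists_infinite_fiber fun m =>
    (⟨d m, Nat.lt_succ_of_le (hd m)⟩ : Fin (B + 1))
  refine ⟨D, fun n => ?_⟩
  obtain ⟨m, hm, hnm⟩ := (Set.infinite_coe_iff.1 hD).exists_gt n
  exact ⟨m, hnm.le, congrArg Fin.val hm ▸ hP m⟩

theorem theorem2 :
    (∃ D : ℕ, ∀ n : ℕ, ∃ (V : Type) (X : CubeComplex V),
      X.IsCAT0 ∧ Finite V ∧ X.HasMaxDegree D ∧
      (n : ℕ∞) < X.crossingGraph.chromaticNumber ∧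
      ∀ k : ℕ, CubeComplex.EmbedsInTrees.{0, w} X k → n < k) ∧
    (∃ (V : Type) (X : CubeComplex V) (D : ℕ),
      X.IsCAT0 ∧ Infinite V ∧ X.HasDim 5 ∧ X.HasMaxDegree D ∧
      X.crossingGraph.chromaticNumber = ⊤ ∧
      ∀ k : ℕ, ¬ CubeComplex.EmbedsInTrees.{0, w} X k) := by
  choose N hN using exists_nat_forall_not_colorable_crossingGraph
  constructor
  · obtain ⟨D, hD⟩ := exists_forall_exists_ge_of_forall_exists_le fun m =>
      exists_hasMaxDegree_burlingBoxes (N m)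
    refine ⟨D, fun n => ?_⟩
    obtain ⟨m, hnm, hm⟩ := hD n
    have not_colorable := fun h : SimpleGraph.Colorable _ n => hN m (N m) le_rfl (h.mono hnm)
    exact ⟨_, _, Config.isCAT0_cubeComplex, Event.finite_boxConfig finite_top_length_le (N m), hm,
      CubeComplex.lt_chromaticNumber_and_lt not_colorable⟩
  · obtain ⟨D, -, hD⟩ := exists_hasMaxDegree_burlingBoxes ⊤
    have large (n : ℕ) := CubeComplex.lt_chromaticNumber_and_lt.{0, w} (hN n ⊤ le_top)
    exact ⟨_, _, D, Config.isCAT0_cubeComplex, Event.infinite_boxConfig,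
      hasDim_boxComplex_burlingBoxes, hD, ENat.eq_top_iff_forall_gt.2 fun n => (large n).1,
      fun k hk => lt_irrefl k ((large k).2 k hk)⟩
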